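/- Let $n\ge 1$, let $\mathbb B^n=\{z\in\mathbb C^n:|z|<1\}$, let $\lambda>n$ be real, and let $d\mu_\lambda(z)=\frac{\Gamma(\lambda)}{n!\,\Gamma(\lambda-n)}(1-|z|^2)^{\lambda-n-1}dv(z)$, where $v$ is the Lebesgue measure on $\mathbb B^n$ normalized to total mass one. Let $\mathcal H^2_\lambda$ be the weighted Bergman space of holomorphic functions in $L^2(\mathbb B^n,\mu_\lambda)$, with reproducing kernel elements $K_w$, so that $f(w)=\langle f,K_w\rangle$. For $\varphi\in L^\infty(\mathbb B^n)$ let $T^{(\lambda)}_\varphi f=P_\lambda(\varphi f)$ be the Toeplitz operator on $\mathcal H^2_\lambda$, where $P_\lambda$ is the orthogonal projection of $L^2(\mathbb B^n,\mu_\lambda)$ onto $\mathcal H^2_\lambda$. Inner products are linear in the first variable. Let $G=\mathrm{SU}(n,1)$ act on $\mathbb B^n$ by $\begin{pmatrix}a&v\\ w^t&d\end{pmatrix}\cdot z=\frac{az+v}{w^tz+d}$. On the universal covering group $\widetilde G$, which acts on $\mathbb B^n$ through $G$, let $j_\lambda(g,z)=(w^tz+d)^{-\lambda}$ be defined by the continuous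 branch of $\log(w^tz+d)$ that is determined by $g\in\widetilde G$. Let $H\subseteq G$ be a closed subgroup with inverse image $\widetilde H\subseteq\widetilde G$, let $z_0\in\mathbb B^n$, and let $M=H\cdot z_0\cong H/H_{z_0}\cong\widetilde H/\widetilde H_{z_0}$. Let $\mu$ be a non-zero $H$-invariant Borel measure on $M$ that is finite on compact sets. For $k\in\widetilde H_{z_0}$ put $\chi_\lambda(k)=j_\lambda(k,z_0)^{-1}$, a unitary character of $\widetilde H_{z_0}$. Let $L^2_{\chi_\lambda}(M)$ be the space of measurable $f:\widetilde H\to\mathbb C$, modulo equality almost everywhere, such that $f(hk)=\chi_\lambda(k)^{-1}f(h)$ for all $h\in\widetilde H$, $k\in\widetilde H_{z_0}$, and $\int_M|f|^2\,d\mu<\infty$ (note that $|f|$ descends to $M$). Assume that $M$ is restriction injective, i.e. holomorphic functions on $\mathbb B^n$ are determined by their restrictions to $M$, and that the function $h\mapsto j_\lambda(h,z_0)$ lies in $L^2_{\chi_\lambda}(M)$. Define the restriction operator $R$ from $\mathcal H^2_\lambda$ to $L^2_{\chi_\lambda}(M)$ by $Rf(h)=j_\lambda(h,z_0)f(h\cdot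 z_0)$, with domain the set of all $f\in\mathcal H^2_\lambda$ for which $Rf$ is square integrable, and let $\mathcal B_\lambda$ be the closure of its range. Let $\varphi\in L^\infty(\mathbb B^n)$ be $H$-invariant, and define $\nu_\varphi:\widetilde H\to\mathbb C$ by $$\nu_\varphi(h)=j_\lambda(h,z_0)\,\langle\varphi K_{z_0},K_{h\cdot z_0}\rangle_{L^2(\mathbb B^n,\mu_\lambda)}=j_\lambda(h,z_0)\int_{\mathbb B^n}\varphi(z)K_{z_0}(z)\overline{K_{h\cdot z_0}(z)}\,d\mu_\lambda(z).$$ Then $R$ is densely defined, and for every $f\in L^2_{\chi_\lambda}(M)$ the following hold. The element $f$ lies in the domain of the adjoint $R^*$, and $T^{(\lambda)}_\varphi R^*f$ lies in the domain of $R$. For every $h\in\widetilde H$ the function $k\mapsto f(k)\,\nu_\varphi(k^{-1}h)$ descends to an integrable function on $M$. Finally, $$R\,T^{(\lambda)}_\varphi R^*f=f*\nu_\varphi,\qquad (f*\nu_\varphi)(h)=\int_{H/H_{z_0}}f(k)\,\nu_\varphi(k^{-1}h)\,d\mu(k),$$ pointwise for all $h\in\widetilde H$ and as elements of $L^2_{\chi_\lambda}(M)$;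 in particular $R\,T^{(\lambda)}_\varphi R^*f\in\mathcal B_\lambda$. -/

import Mathlib

open MeasureTheory Metric
open scoped ENNReal ComplexConjugate Matrix

namespace BallToeplitz

noncomputable section

/-- `ℂⁿ` with its Euclidean norm. -/
abbrev Cn (n : ℕ) : Type := EuclideanSpace ℂ (Fin n)

/-- The Lebesgue measure on the unit ball of `ℂⁿ`, normalised to a probability measure. -/
def ballVolume (n : ℕ) : Measure (Cn n) :=
  (volume (ball (0 : Cn n) 1))⁻¹ • (volume : Measure (Cn n)).restrict (ball 0 1)

/-- The constant `c_lam = Γ(lam) / (n! Γ(lam - n))`. -/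
def bergmanConst (n : ℕ) (lam : ℝ) : ℝ :=
  Real.Gamma lam / ((n.factorial : ℝ) * Real.Gamma (lam - n))

/-- The measure `dμ_lam(z) = c_lam (1 - |z|²) ^ (lam - n - 1) dv(z)` on the unit ball. -/
def bergmanMeasure (n : ℕ) (lam : ℝ) : Measure (Cn n) :=
  (ballVolume n).withDensity fun z =>
    ENNReal.ofReal (bergmanConst n lam * (1 - ‖z‖ ^ 2) ^ (lam - n - 1))

theorem bergmanConst_pos (n : ℕ) (lam : ℝ) [hlam : Fact ((n : ℝ) < lam)] :
    0 < bergmanConst n lam := by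
  have h := hlam.out
  have h0 : (0 : ℝ) ≤ n := Nat.cast_nonneg n
  have h1 : 0 < Real.Gamma lam := Real.Gamma_pos_of_pos (by linarith)
  have h2 : 0 < Real.Gamma (lam - n) := Real.Gamma_pos_of_pos (by linarith)
  have h3 : (0 : ℝ) < n.factorial := by exact_mod_cast n.factorial_pos
  exact div_pos h1 (mul_pos h3 h2)

/-- On smaller balls the Lebesgue measure is dominated by the weighted measure. -/
theorem volume_restrict_le (n : ℕ) (lam : ℝ) [Fact ((n : ℝ) < lam)] {s : ℝ} (hs0 : 0 ≤ s)
    (hs : s < 1) : ∃ C : ℝ≥0∞, C ≠ ∞ ∧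
      (volume : Measure (Cn n)).restrict (ball 0 s) ≤ C • bergmanMeasure n lam := by
  set g : Cn n → ℝ := fun z => bergmanConst n lam * (1 - ‖z‖ ^ 2) ^ (lam - n - 1) with hg
  have hpos : ∀ z ∈ closedBall (0 : Cn n) s, 0 < 1 - ‖z‖ ^ 2 := by
    intro z hz
    have : ‖z‖ ≤ s := by simpa using hz
    have h0 := norm_nonneg z
    nlinarith
  have hcont : ContinuousOn g (closedBall 0 s) := by
    refine continuousOn_const.mul (ContinuousOn.rpow_const ?_ ?_)
    · fun_prop
    · intro z hz
      exact Or.inl (hpos z hz).ne'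
  obtain ⟨z0, hz0, hmin⟩ := (isCompact_closedBall (0 : Cn n) s).exists_isMinOn
    ⟨0, by simpa using hs0⟩ hcont
  set m : ℝ := g z0 with hm
  have hmpos : 0 < m := mul_pos (bergmanConst_pos n lam) (Real.rpow_pos_of_pos (hpos z0 hz0) _)
  set V : ℝ≥0∞ := volume (ball (0 : Cn n) 1) with hV
  have hV0 : V ≠ 0 := (measure_ball_pos volume _ one_pos).ne'
  have hVt : V ≠ ∞ := measure_ball_lt_top.ne
  have hm0 : ENNReal.ofReal m ≠ 0 := by simpa using hmpos
  refine ⟨V * (ENNReal.ofReal m)⁻¹, ENNReal.mul_ne_top hVt (ENNReal.inv_ne_top.2 hm0), ?_⟩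
  refine Measure.le_iff.2 fun A hA => ?_
  have hsub : ball (0 : Cn n) s ⊆ ball 0 1 := ball_subset_ball hs.le
  have hmeas : (bergmanMeasure n lam) A =
      V⁻¹ * ∫⁻ z in A ∩ ball 0 1, ENNReal.ofReal (g z) := by
    rw [bergmanMeasure, withDensity_apply _ hA, ballVolume, Measure.restrict_smul,
      lintegral_smul_measure, Measure.restrict_restrict hA]
    rfl
  have hlow : ENNReal.ofReal m * volume (A ∩ ball 0 s) ≤
      ∫⁻ z in A ∩ ball 0 1, ENNReal.ofReal (g z) := by
    calc ENNReal.ofReal m * volume (A ∩ ball 0 s)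
        = ∫⁻ _ in A ∩ ball 0 s, ENNReal.ofReal m := by simp
      _ ≤ ∫⁻ z in A ∩ ball 0 s, ENNReal.ofReal (g z) := by
          refine setLIntegral_mono' (hA.inter measurableSet_ball) fun z hz => ?_
          exact ENNReal.ofReal_le_ofReal (hmin (ball_subset_closedBall hz.2))
      _ ≤ _ := lintegral_mono_set (Set.inter_subset_inter_right _ hsub)
  rw [Measure.restrict_apply hA, Measure.smul_apply, smul_eq_mul, hmeas]
  calc volume (A ∩ ball 0 s)
      = (ENNReal.ofReal m)⁻¹ * (ENNReal.ofReal m * volume (A ∩ ball 0 s)) := by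
        rw [← mul_assoc, ENNReal.inv_mul_cancel hm0 ENNReal.ofReal_ne_top, one_mul]
    _ ≤ (ENNReal.ofReal m)⁻¹ * ∫⁻ z in A ∩ ball 0 1, ENNReal.ofReal (g z) := by gcongr
    _ = V * (ENNReal.ofReal m)⁻¹ * (V⁻¹ * ∫⁻ z in A ∩ ball 0 1, ENNReal.ofReal (g z)) := by
        rw [show V * (ENNReal.ofReal m)⁻¹ * (V⁻¹ * ∫⁻ z in A ∩ ball 0 1, ENNReal.ofReal (g z))
          = (V * V⁻¹) * ((ENNReal.ofReal m)⁻¹ * ∫⁻ z in A ∩ ball 0 1, ENNReal.ofReal (g z)) by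
            ring, ENNReal.mul_inv_cancel hV0 hVt, one_mul]

/-- Multiplication by `exp (i θ)` as a real linear isometry of `ℂⁿ`. -/
def rot (n : ℕ) (θ : ℝ) : Cn n ≃ₗᵢ[ℝ] Cn n :=
  LinearIsometryEquiv.ofSurjective
    { toFun := fun v => Complex.exp (θ * Complex.I) • v
      map_add' := fun u v => smul_add _ u v
      map_smul' := fun c v => by simp only [RingHom.id_apply]; exact smul_comm _ c v
      norm_map' := fun v => by
        simp [norm_smul, Complex.norm_exp_ofReal_mul_I] }
    (fun v => ⟨Complex.exp (-(θ * Complex.I)) • v, by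
      simp [smul_smul, ← Complex.exp_add]⟩)

theorem rot_apply (n : ℕ) (θ : ℝ) (v : Cn n) :
    rot n θ v = Complex.exp (θ * Complex.I) • v := rfl

/-- The mean value inequality on circles. -/
theorem enorm_le_circle {n : ℕ} {F : Cn n → ℂ} {w : Cn n} {ρ : ℝ}
    (hF : DifferentiableOn ℂ F (ball w ρ)) {v : Cn n} (hv : ‖v‖ < ρ) :
    ENNReal.ofReal (2 * Real.pi) * ‖F w‖ₑ ≤
      ∫⁻ θ in Set.Ioc 0 (2 * Real.pi), ‖F (w + rot n θ v)‖ₑ := by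
  have hmaps : ∀ t : ℂ, ‖t‖ ≤ 1 → w + t • v ∈ ball w ρ := by
    intro t ht
    rw [mem_ball, dist_eq_norm, add_sub_cancel_left, norm_smul]
    calc ‖t‖ * ‖v‖ ≤ 1 * ‖v‖ := by gcongr
      _ < ρ := by simpa using hv
  have hd : DifferentiableOn ℂ (fun t : ℂ => F (w + t • v)) (closedBall 0 |1|) := by
    refine hF.comp (f := fun t : ℂ => w + t • v) (by fun_prop) ?_
    intro t ht
    exact hmaps t (by simpa using ht)
  have hmv := (hd.diffContOnCl_ball (U := closedBall 0 |1|) subset_rfl).circleAverage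
  rw [Real.circleAverage_def, intervalIntegral.integral_of_le (by positivity)] at hmv
  have h2 : F w = (2 * Real.pi)⁻¹ • ∫ θ in Set.Ioc 0 (2 * Real.pi), F (w + rot n θ v) := by
    have : F w = F (w + (0 : ℂ) • v) := by simp
    rw [this, ← hmv]
    simp [circleMap, rot_apply]
  have h3 : (2 * Real.pi) • F w = ∫ θ in Set.Ioc 0 (2 * Real.pi), F (w + rot n θ v) := by
    rw [h2, smul_smul, mul_inv_cancel₀ (by positivity), one_smul]
  calc ENNReal.ofReal (2 * Real.pi) * ‖F w‖ₑ = ‖(2 * Real.pi) • F w‖ₑ := by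
        rw [enorm_smul, Real.enorm_of_nonneg (by positivity)]
    _ ≤ _ := by rw [h3]; exact enorm_integral_le_lintegral_enorm _

/-- The mean value inequality on balls. -/
theorem enorm_mul_volume_le {n : ℕ} {F : Cn n → ℂ} {w : Cn n} {ρ : ℝ}
    (hF : DifferentiableOn ℂ F (ball w ρ)) :
    ‖F w‖ₑ * volume (ball (0 : Cn n) ρ) ≤ ∫⁻ z in ball w ρ, ‖F z‖ₑ := by
  set G : Cn n → ℝ≥0∞ := (ball w ρ).indicator fun z => ‖F z‖ₑ with hG
  have hGm : Measurable G := by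
    have h1 : Measurable ((ball w ρ).indicator F) := by
      classical
      rw [← Set.piecewise_eq_indicator]
      exact hF.continuousOn.measurable_piecewise continuousOn_const measurableSet_ball
    have : G = fun z => ‖(ball w ρ).indicator F z‖ₑ := by
      ext z
      simp only [hG]
      by_cases hz : z ∈ ball w ρ <;> simp [hz]
    rw [this]
    exact h1.enorm
  have hmem : ∀ (θ : ℝ) (v : Cn n), w + rot n θ v ∈ ball w ρ ↔ v ∈ ball (0 : Cn n) ρ := by
    intro θ v
    simp [mem_ball, dist_eq_norm]
  have hshift : ∀ θ : ℝ, ∫⁻ v, G (w + rot n θ v) = ∫⁻ z in ball w ρ, ‖F z‖ₑ := by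
    intro θ
    rw [(rot n θ).measurePreserving.lintegral_comp (f := fun v => G (w + v)) (by fun_prop),
      lintegral_add_left_eq_self (fun v => G v) w, hG, lintegral_indicator measurableSet_ball]
  have hcirc : ∀ v ∈ ball (0 : Cn n) ρ, ENNReal.ofReal (2 * Real.pi) * ‖F w‖ₑ ≤
      ∫⁻ θ in Set.Ioc 0 (2 * Real.pi), G (w + rot n θ v) := by
    intro v hv
    refine (enorm_le_circle hF (by simpa using hv)).trans (le_of_eq ?_)
    refine lintegral_congr fun θ => ?_
    simp only [hG]
    rw [Set.indicator_of_mem ((hmem θ v).2 hv)]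
  have hpi0 : ENNReal.ofReal (2 * Real.pi) ≠ 0 := by
    simp [Real.pi_pos]
  have key : ENNReal.ofReal (2 * Real.pi) * (‖F w‖ₑ * volume (ball (0 : Cn n) ρ)) ≤
      ENNReal.ofReal (2 * Real.pi) * ∫⁻ z in ball w ρ, ‖F z‖ₑ := by
    calc ENNReal.ofReal (2 * Real.pi) * (‖F w‖ₑ * volume (ball (0 : Cn n) ρ))
        = ∫⁻ _ in ball (0 : Cn n) ρ, ENNReal.ofReal (2 * Real.pi) * ‖F w‖ₑ := by
          simp [mul_assoc]
      _ ≤ ∫⁻ v in ball (0 : Cn n) ρ, ∫⁻ θ in Set.Ioc 0 (2 * Real.pi), G (w + rot n θ v) :=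
          setLIntegral_mono' measurableSet_ball hcirc
      _ ≤ ∫⁻ v, ∫⁻ θ in Set.Ioc 0 (2 * Real.pi), G (w + rot n θ v) :=
          setLIntegral_le_lintegral _ _
      _ = ∫⁻ θ in Set.Ioc 0 (2 * Real.pi), ∫⁻ v, G (w + rot n θ v) := by
          refine lintegral_lintegral_swap ?_
          refine Measurable.aemeasurable (hGm.comp ?_)
          simp only [rot_apply]
          fun_prop
      _ = ENNReal.ofReal (2 * Real.pi) * ∫⁻ z in ball w ρ, ‖F z‖ₑ := by
          simp [hshift, mul_comm]
  exact (ENNReal.mul_le_mul_iff_right hpi0 ENNReal.ofReal_ne_top).1 key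

/-- Point evaluations of holomorphic functions are locally uniformly bounded by the norm of
`L²(μ_lam)`. -/
theorem exists_enorm_le (n : ℕ) (lam : ℝ) [Fact ((n : ℝ) < lam)] {s : ℝ} (hs0 : 0 ≤ s)
    (hs : s < 1) : ∃ C : ℝ≥0∞, C ≠ ∞ ∧ ∀ F : Cn n → ℂ, DifferentiableOn ℂ F (ball 0 1) →
      ∀ w ∈ closedBall (0 : Cn n) s, ‖F w‖ₑ ≤ C * eLpNorm F 2 (bergmanMeasure n lam) := by
  set ρ : ℝ := (1 - s) / 2 with hρ
  have hρ0 : 0 < ρ := by rw [hρ]; linarith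
  obtain ⟨D, hD, hle⟩ := volume_restrict_le n lam (s := s + ρ) (by linarith) (by linarith)
  set W : ℝ≥0∞ := volume (ball (0 : Cn n) ρ) with hW
  have hW0 : W ≠ 0 := (measure_ball_pos volume _ hρ0).ne'
  have hWt : W ≠ ∞ := measure_ball_lt_top.ne
  refine ⟨W⁻¹ * (W ^ (1 / 2 : ℝ) * D ^ (1 / 2 : ℝ)), ?_, ?_⟩
  · refine ENNReal.mul_ne_top (ENNReal.inv_ne_top.2 hW0) (ENNReal.mul_ne_top ?_ ?_)
    · exact ENNReal.rpow_ne_top_of_nonneg (by norm_num) hWt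
    · exact ENNReal.rpow_ne_top_of_nonneg (by norm_num) hD
  intro F hF w hw
  have hws : ‖w‖ ≤ s := by simpa using hw
  have hsub : ball w ρ ⊆ ball (0 : Cn n) (s + ρ) := by
    refine ball_subset_ball' ?_
    rw [dist_zero_right]
    linarith
  have hsub1 : ball w ρ ⊆ ball (0 : Cn n) 1 := hsub.trans (ball_subset_ball (by linarith))
  have hFw := hF.mono hsub1
  have h1 := enorm_mul_volume_le hFw
  have hWw : volume (ball w ρ) = W := by
    rw [hW, Measure.addHaar_ball_center]
  have hmeas : AEStronglyMeasurable F (volume.restrict (ball w ρ)) :=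
    hFw.continuousOn.aestronglyMeasurable measurableSet_ball
  have h2 : ∫⁻ z in ball w ρ, ‖F z‖ₑ ≤
      eLpNorm F 2 (volume.restrict (ball w ρ)) * W ^ (1 / 2 : ℝ) := by
    have := eLpNorm_le_eLpNorm_mul_rpow_measure_univ (μ := volume.restrict (ball w ρ))
      (p := 1) (q := 2) (f := F) (by norm_num) hmeas
    rw [eLpNorm_one_eq_lintegral_enorm, Measure.restrict_apply_univ, hWw] at this
    refine this.trans (le_of_eq ?_)
    norm_num
  have h3 : eLpNorm F 2 (volume.restrict (ball w ρ)) ≤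
      D ^ (1 / 2 : ℝ) * eLpNorm F 2 (bergmanMeasure n lam) := by
    calc eLpNorm F 2 (volume.restrict (ball w ρ))
        ≤ eLpNorm F 2 (D • bergmanMeasure n lam) :=
          eLpNorm_mono_measure _ ((Measure.restrict_mono hsub le_rfl).trans hle)
      _ = _ := by
          rw [eLpNorm_smul_measure_of_ne_top (by norm_num)]
          norm_num
  calc ‖F w‖ₑ = W⁻¹ * (‖F w‖ₑ * W) := by
        rw [mul_comm, mul_assoc, ENNReal.mul_inv_cancel hW0 hWt, mul_one]
    _ ≤ W⁻¹ * ((D ^ (1 / 2 : ℝ) * eLpNorm F 2 (bergmanMeasure n lam)) * W ^ (1 / 2 : ℝ)) := by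
        refine mul_le_mul_right (h1.trans (h2.trans ?_)) _
        exact mul_le_mul_left h3 _
    _ = _ := by ring

/-- A locally uniform limit of holomorphic functions on the unit ball is holomorphic. -/
theorem differentiableOn_of_limit {n : ℕ} {f : ℕ → Cn n → ℂ} {F : Cn n → ℂ}
    (hf : ∀ k, DifferentiableOn ℂ (f k) (ball 0 1))
    (hlim : ∀ z ∈ ball (0 : Cn n) 1, Filter.Tendsto (fun k => f k z) Filter.atTop (nhds (F z)))
    (hcau : ∀ s : ℝ, 0 ≤ s → s < 1 → ∀ ε > 0, ∃ N, ∀ k ≥ N, ∀ l ≥ N,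
      ∀ z ∈ closedBall (0 : Cn n) s, ‖f k z - f l z‖ ≤ ε) :
    DifferentiableOn ℂ F (ball 0 1) := by
  intro x hx
  have hx1 : ‖x‖ < 1 := by simpa using hx
  set ρ : ℝ := (1 - ‖x‖) / 4 with hρ
  have hρ0 : 0 < ρ := by rw [hρ]; linarith
  have hfd : UniformCauchySeqOn (fun k z => fderiv ℂ (f k) z) Filter.atTop (ball x ρ) := by
    rw [Metric.uniformCauchySeqOn_iff]
    intro ε hε
    obtain ⟨N, hN⟩ := hcau (‖x‖ + 2 * ρ) (by positivity) (by rw [hρ]; linarith) (ε * ρ / 4)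
      (by positivity)
    refine ⟨N, fun k hk l hl z hz => ?_⟩
    have hz1 : dist z x < ρ := hz
    have hsub : ball z ρ ⊆ closedBall (0 : Cn n) (‖x‖ + 2 * ρ) := by
      intro y hy
      have hy1 : dist y z < ρ := hy
      rw [mem_closedBall]
      have h1 := dist_triangle y z 0
      have h2 := dist_triangle z x 0
      rw [dist_zero_right x] at h2
      linarith
    have hsub1 : ball z ρ ⊆ ball (0 : Cn n) 1 := by
      intro y hy
      have := hsub hy
      rw [mem_closedBall] at this
      rw [mem_ball]
      have : ‖x‖ + 2 * ρ < 1 := by rw [hρ]; linarith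
      linarith
    have hzb : z ∈ ball (0 : Cn n) 1 := hsub1 (mem_ball_self hρ0)
    have hdk : DifferentiableAt ℂ (f k) z := (hf k z hzb).differentiableAt (isOpen_ball.mem_nhds hzb)
    have hdl : DifferentiableAt ℂ (f l) z := (hf l z hzb).differentiableAt (isOpen_ball.mem_nhds hzb)
    have hd : DifferentiableOn ℂ (fun y => f k y - f l y) (ball z ρ) :=
      ((hf k).mono hsub1).sub ((hf l).mono hsub1)
    have hb := Complex.norm_fderiv_le_div_of_mapsTo_ball (R₂ := ε * ρ / 2) hd (by
      intro y hy
      rw [mem_closedBall, dist_eq_norm]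
      have h1 := hN k hk l hl y (hsub hy)
      have h2 := hN k hk l hl z (hsub (mem_ball_self hρ0))
      have h3 := norm_sub_le (f k y - f l y) (f k z - f l z)
      linarith) hρ0
    rw [dist_eq_norm]
    have hsubd : fderiv ℂ (f k) z - fderiv ℂ (f l) z = fderiv ℂ (fun y => f k y - f l y) z :=
      (fderiv_fun_sub hdk hdl).symm
    rw [hsubd]
    refine hb.trans_lt ?_
    rw [div_lt_iff₀ hρ0]
    nlinarith
  have hex : ∀ z : Cn n, ∃ L : Cn n →L[ℂ] ℂ, z ∈ ball x ρ →
      Filter.Tendsto (fun k => fderiv ℂ (f k) z) Filter.atTop (nhds L) := by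
    intro z
    by_cases hz : z ∈ ball x ρ
    · obtain ⟨L, hL⟩ := cauchySeq_tendsto_of_complete (hfd.cauchySeq hz)
      exact ⟨L, fun _ => hL⟩
    · exact ⟨0, fun h => absurd h hz⟩
  choose F' hF' using hex
  have hunif := hfd.tendstoUniformlyOn_of_tendsto (fun z hz => hF' z hz)
  have hsub : ball x ρ ⊆ ball (0 : Cn n) 1 := by
    refine ball_subset_ball' ?_
    rw [dist_zero_right, hρ]
    linarith
  have hder : HasFDerivAt F (F' x) x :=
    hasFDerivAt_of_tendstoUniformlyOn isOpen_ball hunif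
      (fun k z hz => ((hf k z (hsub hz)).differentiableAt
        (isOpen_ball.mem_nhds (hsub hz))).hasFDerivAt)
      (fun z hz => hlim z (hsub hz)) (mem_ball_self hρ0)
  exact hder.differentiableAt.differentiableWithinAt

/-- The Hilbert space `L²(𝔹ⁿ, μ_lam)`. -/
abbrev L2 (n : ℕ) (lam : ℝ) : Type := Lp ℂ 2 (bergmanMeasure n lam)

/-- The weighted Bergman space: the classes in `L²(𝔹ⁿ, μ_lam)` of holomorphic functions. -/
def Bergman (n : ℕ) (lam : ℝ) : Submodule ℂ (L2 n lam) where
  carrier := {f | ∃ F : Cn n → ℂ, DifferentiableOn ℂ F (ball 0 1) ∧ f =ᵐ[bergmanMeasure n lam] F}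
  add_mem' := by
    rintro f g ⟨F, hF, hfF⟩ ⟨G, hG, hgG⟩
    refine ⟨fun z => F z + G z, hF.add hG, ?_⟩
    filter_upwards [Lp.coeFn_add f g, hfF, hgG] with z h1 h2 h3
    rw [h1, Pi.add_apply, h2, h3]
  zero_mem' := ⟨fun _ => 0, differentiableOn_const _, Lp.coeFn_zero _ _ _⟩
  smul_mem' := by
    rintro c f ⟨F, hF, hfF⟩
    refine ⟨fun z => c * F z, hF.const_mul c, ?_⟩
    filter_upwards [Lp.coeFn_smul c f, hfF] with z h1 h2
    simp [h1, h2]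

/-- The holomorphic function on the ball represented by an element of the Bergman space. -/
def hol {n : ℕ} {lam : ℝ} (f : Bergman n lam) : Cn n → ℂ := Classical.choose f.2

theorem hol_differentiableOn {n : ℕ} {lam : ℝ} (f : Bergman n lam) :
    DifferentiableOn ℂ (hol f) (ball 0 1) := (Classical.choose_spec f.2).1

theorem coe_ae_eq_hol {n : ℕ} {lam : ℝ} (f : Bergman n lam) :
    (f : L2 n lam) =ᵐ[bergmanMeasure n lam] hol f := (Classical.choose_spec f.2).2

/-- Two holomorphic functions which agree almost everywhere agree on the ball. -/
theorem eq_of_ae_eq {n : ℕ} {lam : ℝ} [Fact ((n : ℝ) < lam)] {F G : Cn n → ℂ}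
    (hF : DifferentiableOn ℂ F (ball 0 1)) (hG : DifferentiableOn ℂ G (ball 0 1))
    (h : F =ᵐ[bergmanMeasure n lam] G) {z : Cn n} (hz : z ∈ ball (0 : Cn n) 1) : F z = G z := by
  have hz1 : ‖z‖ < 1 := by simpa using hz
  obtain ⟨C, -, hC⟩ := exists_enorm_le n lam (norm_nonneg z) hz1
  have h1 := hC (fun z => F z - G z) (hF.sub hG) z (by simp)
  have h2 : eLpNorm (fun z => F z - G z) 2 (bergmanMeasure n lam) = 0 := by
    have : (fun z => F z - G z) =ᵐ[bergmanMeasure n lam] fun _ => (0 : ℂ) := by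
      filter_upwards [h] with z hz
      simp [hz]
    rw [eLpNorm_congr_ae this]
    simp
  rw [h2, mul_zero] at h1
  simpa [sub_eq_zero] using h1

theorem eLpNorm_hol {n : ℕ} {lam : ℝ} (f : Bergman n lam) :
    eLpNorm (hol f) 2 (bergmanMeasure n lam) = ENNReal.ofReal ‖f‖ := by
  rw [← eLpNorm_congr_ae (coe_ae_eq_hol f), ← Lp.enorm_def, ← ofReal_norm]
  rfl

theorem hol_add {n : ℕ} {lam : ℝ} [Fact ((n : ℝ) < lam)] (f g : Bergman n lam) {z : Cn n}
    (hz : z ∈ ball (0 : Cn n) 1) : hol (f + g) z = hol f z + hol g z := by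
  refine eq_of_ae_eq (lam := lam) (G := fun z => hol f z + hol g z) (hol_differentiableOn _)
    ((hol_differentiableOn f).add (hol_differentiableOn g)) ?_ hz
  filter_upwards [coe_ae_eq_hol (f + g), coe_ae_eq_hol f, coe_ae_eq_hol g,
    Lp.coeFn_add (f : L2 n lam) g] with w h1 h2 h3 h4
  rw [← h1, ← h2, ← h3, Submodule.coe_add, h4]
  rfl

theorem hol_smul {n : ℕ} {lam : ℝ} [Fact ((n : ℝ) < lam)] (c : ℂ) (f : Bergman n lam) {z : Cn n}
    (hz : z ∈ ball (0 : Cn n) 1) : hol (c • f) z = c * hol f z := by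
  refine eq_of_ae_eq (lam := lam) (G := fun z => c * hol f z) (hol_differentiableOn _)
    ((hol_differentiableOn f).const_mul c) ?_ hz
  filter_upwards [coe_ae_eq_hol (c • f), coe_ae_eq_hol f,
    Lp.coeFn_smul c (f : L2 n lam)] with w h1 h2 h3
  rw [← h1, ← h2, Submodule.coe_smul, h3]
  rfl

theorem exists_norm_hol_le (n : ℕ) (lam : ℝ) [Fact ((n : ℝ) < lam)] {s : ℝ} (hs0 : 0 ≤ s)
    (hs : s < 1) : ∃ C : ℝ, 0 ≤ C ∧ ∀ f : Bergman n lam,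
      ∀ w ∈ closedBall (0 : Cn n) s, ‖hol f w‖ ≤ C * ‖f‖ := by
  obtain ⟨C, hC, h⟩ := exists_enorm_le n lam hs0 hs
  refine ⟨C.toReal, ENNReal.toReal_nonneg, fun f w hw => ?_⟩
  have h1 := h (hol f) (hol_differentiableOn f) w hw
  rw [eLpNorm_hol, ← ofReal_norm, ← ENNReal.ofReal_toReal hC,
    ← ENNReal.ofReal_mul ENNReal.toReal_nonneg] at h1
  exact (ENNReal.ofReal_le_ofReal_iff (by positivity)).1 h1

theorem hol_sub {n : ℕ} {lam : ℝ} [Fact ((n : ℝ) < lam)] (f g : Bergman n lam) {z : Cn n}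
    (hz : z ∈ ball (0 : Cn n) 1) : hol (f - g) z = hol f z - hol g z := by
  have h := hol_add (f - g) g hz
  rw [sub_add_cancel] at h
  rw [h, add_sub_cancel_right]

theorem isClosed_bergman (n : ℕ) (lam : ℝ) [Fact ((n : ℝ) < lam)] :
    IsClosed (Bergman n lam : Set (L2 n lam)) := by
  refine IsSeqClosed.isClosed fun u g hu hg => ?_
  set f : ℕ → Bergman n lam := fun k => ⟨u k, hu k⟩ with hf
  have hcs : CauchySeq f := by
    have : CauchySeq u := hg.cauchySeq
    rw [Metric.cauchySeq_iff] at this ⊢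
    exact this
  have hcau : ∀ s : ℝ, 0 ≤ s → s < 1 → ∀ ε > 0, ∃ N, ∀ k ≥ N, ∀ l ≥ N,
      ∀ z ∈ closedBall (0 : Cn n) s, ‖hol (f k) z - hol (f l) z‖ ≤ ε := by
    intro s hs0 hs ε hε
    obtain ⟨C, hC0, hC⟩ := exists_norm_hol_le n lam hs0 hs
    obtain ⟨N, hN⟩ := Metric.cauchySeq_iff.1 hcs (ε / (C + 1)) (by positivity)
    refine ⟨N, fun k hk l hl z hz => ?_⟩
    have hzb : z ∈ ball (0 : Cn n) 1 := closedBall_subset_ball hs hz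
    rw [← hol_sub _ _ hzb]
    have h1 := hC (f k - f l) z hz
    have h2 := hN k hk l hl
    rw [dist_eq_norm] at h2
    have h3 : (C + 1) * (ε / (C + 1)) = ε := by field_simp
    have h4 := norm_nonneg (f k - f l)
    nlinarith
  have hex : ∀ z : Cn n, ∃ a : ℂ, z ∈ ball (0 : Cn n) 1 →
      Filter.Tendsto (fun k => hol (f k) z) Filter.atTop (nhds a) := by
    intro z
    by_cases hz : z ∈ ball (0 : Cn n) 1
    · have hz1 : ‖z‖ < 1 := by simpa using hz
      have : CauchySeq fun k => hol (f k) z := by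
        rw [Metric.cauchySeq_iff]
        intro ε hε
        obtain ⟨N, hN⟩ := hcau ‖z‖ (norm_nonneg z) hz1 (ε / 2) (by positivity)
        refine ⟨N, fun k hk l hl => ?_⟩
        rw [dist_eq_norm]
        have := hN k hk l hl z (by simp)
        linarith
      obtain ⟨a, ha⟩ := cauchySeq_tendsto_of_complete this
      exact ⟨a, fun _ => ha⟩
    · exact ⟨0, fun h => absurd h hz⟩
  choose F hF using hex
  refine ⟨F, differentiableOn_of_limit (fun k => hol_differentiableOn (f k))
    (fun z hz => hF z hz) hcau, ?_⟩
  obtain ⟨ns, hns, hae⟩ := (tendstoInMeasure_of_tendsto_Lp hg).exists_seq_tendsto_ae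
  have hball : ∀ᵐ z ∂(bergmanMeasure n lam), z ∈ ball (0 : Cn n) 1 := by
    refine (withDensity_absolutelyContinuous _ _).ae_le ?_
    exact Measure.ae_smul_measure (ae_restrict_mem measurableSet_ball) _
  have hall : ∀ᵐ z ∂(bergmanMeasure n lam), ∀ k, (u k : L2 n lam) z = hol (f k) z :=
    ae_all_iff.2 fun k => coe_ae_eq_hol (f k)
  filter_upwards [hae, hball, hall] with z h1 h2 h3
  refine tendsto_nhds_unique h1 ?_
  simp only [h3]
  exact (hF z h2).comp hns.tendsto_atTop

instance (n : ℕ) (lam : ℝ) [Fact ((n : ℝ) < lam)] : CompleteSpace (Bergman n lam) :=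
  (isClosed_bergman n lam).completeSpace_coe

/-- Evaluation at a point `z` of the ball, as a continuous functional on the Bergman space. -/
def evalCLM (n : ℕ) (lam : ℝ) [Fact ((n : ℝ) < lam)] (z : ball (0 : Cn n) 1) :
    Bergman n lam →L[ℂ] ℂ :=
  LinearMap.mkContinuousOfExistsBound
    { toFun := fun f => hol f z
      map_add' := fun f g => hol_add f g z.2
      map_smul' := fun c f => hol_smul c f z.2 }
    (by
      obtain ⟨C, -, hC⟩ := exists_norm_hol_le n lam (norm_nonneg (z : Cn n))
        (mem_ball_zero_iff.1 z.2)
      exact ⟨C, fun f => hC f z (by simp)⟩)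

/-- The reproducing kernel element `K_w`, characterised by `f(w) = ⟨f, K_w⟩`; recall that
Mathlib's inner product is conjugate linear in its first argument. -/
def kernelAt (n : ℕ) (lam : ℝ) [Fact ((n : ℝ) < lam)] (w : ball (0 : Cn n) 1) : Bergman n lam :=
  (InnerProductSpace.toDual ℂ (Bergman n lam)).symm (evalCLM n lam w)

theorem inner_kernelAt (n : ℕ) (lam : ℝ) [Fact ((n : ℝ) < lam)] (w : ball (0 : Cn n) 1)
    (f : Bergman n lam) : inner ℂ (kernelAt n lam w) f = hol f w := by
  rw [kernelAt, InnerProductSpace.toDual_symm_apply]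
  rfl

/-- The Toeplitz operator `f ↦ P (φ f)`, where `P` is the orthogonal projection of
`L²(𝔹ⁿ, μ_lam)` onto the Bergman space. -/
def toeplitz {n : ℕ} {lam : ℝ} [Fact ((n : ℝ) < lam)] (φ : Lp ℂ ∞ (bergmanMeasure n lam))
    (f : Bergman n lam) : Bergman n lam :=
  (Bergman n lam).orthogonalProjectionOnto (φ • (f : L2 n lam) : L2 n lam)

/-! ### The group `SU(n,1)`, its action on the ball and its universal covering group -/

/-- The matrix `J_{n,1} = diag(-1, …, -1, 1)`. -/
def J (n : ℕ) : Matrix (Fin n ⊕ Unit) (Fin n ⊕ Unit) ℂ := Matrix.fromBlocks (-1) 0 0 1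

theorem J_mul_J (n : ℕ) : J n * J n = 1 := by
  simp [J, Matrix.fromBlocks_multiply, Matrix.fromBlocks_one]

/-- The group `SU(n,1)` of complex matrices `A` with `det A = 1` and `A J A* = J`. -/
def SU (n : ℕ) : Subgroup (Matrix.SpecialLinearGroup (Fin n ⊕ Unit) ℂ) where
  carrier := {A | A.1 * J n * A.1ᴴ = J n}
  mul_mem' := by
    intro A B hA hB
    simp only [Set.mem_ofPred_eq, Matrix.SpecialLinearGroup.coe_mul,
      Matrix.conjTranspose_mul] at *
    calc A.1 * B.1 * J n * (B.1ᴴ * A.1ᴴ) = A.1 * (B.1 * J n * B.1ᴴ) * A.1ᴴ := by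
          simp only [Matrix.mul_assoc]
      _ = J n := by rw [hB, hA]
  one_mem' := by simp
  inv_mem' := by
    intro A hA
    simp only [Set.mem_ofPred_eq] at *
    have h1 : (A⁻¹).1 * A.1 = 1 := by
      rw [← Matrix.SpecialLinearGroup.coe_mul, inv_mul_cancel, Matrix.SpecialLinearGroup.coe_one]
    have h2 : A.1ᴴ * (A⁻¹).1ᴴ = 1 := by
      rw [← Matrix.conjTranspose_mul, h1, Matrix.conjTranspose_one]
    calc (A⁻¹).1 * J n * (A⁻¹).1ᴴ = (A⁻¹).1 * (A.1 * J n * A.1ᴴ) * (A⁻¹).1ᴴ := by rw [hA]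
      _ = ((A⁻¹).1 * A.1) * J n * (A.1ᴴ * (A⁻¹).1ᴴ) := by simp only [Matrix.mul_assoc]
      _ = J n := by rw [h1, h2, Matrix.one_mul, Matrix.mul_one]

/-- The underlying matrix of an element of `SU(n,1)`. -/
def mat {n : ℕ} (A : SU n) : Matrix (Fin n ⊕ Unit) (Fin n ⊕ Unit) ℂ := A.1.1

theorem mat_mul {n : ℕ} (A B : SU n) : mat (A * B) = (mat A) * (mat B) := rfl

theorem mat_one {n : ℕ} : mat (1 : SU n) = 1 := rfl

theorem mat_injective {n : ℕ} : Function.Injective (mat (n := n)) :=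
  fun _ _ h => Subtype.ext (Subtype.ext h)

theorem conjTranspose_mul_mat {n : ℕ} (A : SU n) : (mat A)ᴴ * J n * (mat A) = J n := by
  have h : (mat A) * J n * (mat A)ᴴ = J n := A.2
  have h1 : (mat A) * (J n * (mat A)ᴴ * J n) = 1 := by
    rw [← Matrix.mul_assoc, ← Matrix.mul_assoc, h, J_mul_J]
  have h2 : J n * (mat A)ᴴ * J n * (mat A) = 1 := mul_eq_one_comm.1 h1
  calc (mat A)ᴴ * J n * (mat A) = (J n * J n) * ((mat A)ᴴ * J n * (mat A)) := by
        rw [J_mul_J, Matrix.one_mul]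
    _ = J n * (J n * (mat A)ᴴ * J n * (mat A)) := by simp only [Matrix.mul_assoc]
    _ = J n := by rw [h2, Matrix.mul_one]

/-- The vector `(z, 1)` of `ℂⁿ⁺¹`. -/
def hvec {n : ℕ} (z : Cn n) : Fin n ⊕ Unit → ℂ := Sum.elim (fun i => z i) (fun _ => 1)

/-- The denominator `wᵗ z + d` for a matrix with last row `(wᵗ, d)`. -/
def den {n : ℕ} (A : SU n) (z : Cn n) : ℂ :=
  ∑ i, (mat A) (Sum.inr ()) (Sum.inl i) * z i + (mat A) (Sum.inr ()) (Sum.inr ())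

/-- The fractional linear transformation `z ↦ (a z + v) / (wᵗ z + d)`. -/
def moebius {n : ℕ} (A : SU n) (z : Cn n) : Cn n :=
  WithLp.toLp 2 fun i =>
    (∑ k, (mat A) (Sum.inl i) (Sum.inl k) * z k + (mat A) (Sum.inl i) (Sum.inr ())) / den A z

/-- The hermitian form `|v_{n+1}|² - |v_1|² - … - |v_n|²`. -/
def qform {n : ℕ} (v : Fin n ⊕ Unit → ℂ) : ℝ :=
  ‖v (Sum.inr ())‖ ^ 2 - ∑ i, ‖v (Sum.inl i)‖ ^ 2

theorem qform_eq {n : ℕ} (v : Fin n ⊕ Unit → ℂ) :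
    ((qform v : ℝ) : ℂ) = star v ⬝ᵥ (J n *ᵥ v) := by
  have hJ : J n = Matrix.diagonal (Sum.elim (fun _ => -1) (fun _ => 1)) := by
    rw [J, ← Matrix.fromBlocks_diagonal]
    congr 1
    · ext i j; by_cases h : i = j <;> simp [h, Matrix.diagonal]
  rw [hJ]
  simp only [dotProduct, Matrix.mulVec_diagonal, Fintype.sum_sum_type]
  simp [qform, ← Complex.conj_mul']
  ring

theorem qform_mulVec {n : ℕ} (A : SU n) (v : Fin n ⊕ Unit → ℂ) :
    qform ((mat A) *ᵥ v) = qform v := by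
  have : ((qform ((mat A) *ᵥ v) : ℝ) : ℂ) = ((qform v : ℝ) : ℂ) := by
    rw [qform_eq, qform_eq, Matrix.star_mulVec, ← Matrix.dotProduct_mulVec, Matrix.mulVec_mulVec,
      Matrix.mulVec_mulVec, conjTranspose_mul_mat A]
  exact_mod_cast this

theorem qform_hvec {n : ℕ} (z : Cn n) : qform (hvec z) = 1 - ‖z‖ ^ 2 := by
  simp [qform, hvec, EuclideanSpace.norm_sq_eq]

theorem qform_smul {n : ℕ} (c : ℂ) (v : Fin n ⊕ Unit → ℂ) :
    qform (c • v) = ‖c‖ ^ 2 * qform v := by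
  simp [qform, mul_pow, mul_sub, Finset.mul_sum]

theorem mulVec_hvec_inr {n : ℕ} (A : SU n) (z : Cn n) :
    ((mat A) *ᵥ hvec z) (Sum.inr ()) = den A z := by
  simp [Matrix.mulVec, dotProduct, hvec, den]

theorem den_ne_zero {n : ℕ} (A : SU n) {z : Cn n} (hz : z ∈ ball (0 : Cn n) 1) :
    den A z ≠ 0 := by
  intro h
  have hz1 : ‖z‖ < 1 := by simpa using hz
  have h1 := qform_mulVec A (hvec z)
  rw [qform_hvec, qform, mulVec_hvec_inr, h] at h1
  have h2 : 0 ≤ ∑ i, ‖((mat A) *ᵥ hvec z) (Sum.inl i)‖ ^ 2 :=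
    Finset.sum_nonneg fun i _ => by positivity
  have h3 := norm_nonneg z
  norm_num at h1
  nlinarith

theorem mulVec_hvec {n : ℕ} (A : SU n) {z : Cn n} (hz : z ∈ ball (0 : Cn n) 1) :
    (mat A) *ᵥ hvec z = den A z • hvec (moebius A z) := by
  ext i
  rcases i with i | i
  · have := den_ne_zero A hz
    simp [hvec, moebius, Matrix.mulVec, dotProduct]
    field_simp
  · rw [show (Sum.inr i : Fin n ⊕ Unit) = Sum.inr () from rfl, mulVec_hvec_inr]
    simp [hvec]

theorem norm_den_sq_mul {n : ℕ} (A : SU n) {z : Cn n} (hz : z ∈ ball (0 : Cn n) 1) :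
    ‖den A z‖ ^ 2 * (1 - ‖moebius A z‖ ^ 2) = 1 - ‖z‖ ^ 2 := by
  rw [← qform_hvec, ← qform_smul, ← mulVec_hvec A hz, qform_mulVec, qform_hvec]

theorem moebius_mem {n : ℕ} (A : SU n) {z : Cn n} (hz : z ∈ ball (0 : Cn n) 1) :
    moebius A z ∈ ball (0 : Cn n) 1 := by
  have hz1 : ‖z‖ < 1 := by simpa using hz
  have h := norm_den_sq_mul A hz
  have h0 := norm_nonneg z
  have h1 : 0 < ‖den A z‖ ^ 2 * (1 - ‖moebius A z‖ ^ 2) := by rw [h]; nlinarith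
  have h2 : 0 < 1 - ‖moebius A z‖ ^ 2 := pos_of_mul_pos_right h1 (by positivity)
  rw [mem_ball_zero_iff]
  have h3 := norm_nonneg (moebius A z)
  nlinarith

theorem hvec_smul_injective {n : ℕ} {c d : ℂ} {z w : Cn n} (hc : c ≠ 0)
    (h : c • hvec z = d • hvec w) : c = d ∧ z = w := by
  have h1 : c = d := by simpa [hvec] using congrFun h (Sum.inr ())
  subst h1
  refine ⟨rfl, ?_⟩
  ext i
  have := congrFun h (Sum.inl i)
  simpa [hvec, hc] using this

theorem cocycle_aux {n : ℕ} (A B : SU n) {z : Cn n} (hz : z ∈ ball (0 : Cn n) 1) :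
    den (A * B) z = den A (moebius B z) * den B z ∧
      moebius (A * B) z = moebius A (moebius B z) := by
  refine hvec_smul_injective (den_ne_zero _ hz) ?_
  rw [← mulVec_hvec _ hz, mat_mul, ← Matrix.mulVec_mulVec, mulVec_hvec B hz,
    Matrix.mulVec_smul, mulVec_hvec A (moebius_mem B hz), smul_smul, mul_comm]

theorem one_aux {n : ℕ} {z : Cn n} (hz : z ∈ ball (0 : Cn n) 1) :
    den (1 : SU n) z = 1 ∧ moebius (1 : SU n) z = z := by
  refine hvec_smul_injective (den_ne_zero _ hz) ?_
  rw [← mulVec_hvec _ hz, mat_one, Matrix.one_mulVec, one_smul]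

/-- The unit ball `𝔹ⁿ`, as a type. -/
abbrev Ball (n : ℕ) : Type := ball (0 : Cn n) 1

/-- The action of `SU(n,1)` on the unit ball by fractional linear transformations. -/
instance (n : ℕ) : MulAction (SU n) (Ball n) where
  smul A z := ⟨moebius A z, moebius_mem A z.2⟩
  one_smul z := Subtype.ext (one_aux z.2).2
  mul_smul A B z := Subtype.ext (cocycle_aux A B z.2).2

theorem coe_smul {n : ℕ} (A : SU n) (z : Ball n) : ((A • z : Ball n) : Cn n) = moebius A z := rfl

theorem den_mul {n : ℕ} (A B : SU n) (z : Ball n) :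
    den (A * B) z = den A (B • z : Ball n) * den B z := (cocycle_aux A B z.2).1

theorem continuous_den {n : ℕ} (A : SU n) : Continuous fun z : Ball n => den A z := by
  unfold den
  fun_prop

theorem continuous_smul_ball {n : ℕ} (A : SU n) : Continuous fun z : Ball n => A • z := by
  refine Continuous.subtype_mk ?_ _
  refine (PiLp.continuous_toLp 2 _).comp (continuous_pi fun i => ?_)
  refine Continuous.div (by fun_prop) (continuous_den A) fun z => den_ne_zero A z.2

/-- The universal covering group of `SU(n,1)` (for `n ≥ 1`): an element is an element `A` of
`SU(n,1)` together with a continuous branch on the ball of the logarithm of the nowhere vanishing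
function `z ↦ wᵗ z + d`. Indeed `SU(n,1)` retracts onto `U(n)`, whose fundamental group is
generated by a loop along which `d` has winding number one, so that the choices of the branch
form the simply connected covering. -/
@[ext]
structure Cover (n : ℕ) where
  /-- The image in `SU(n,1)`. -/
  base : SU n
  /-- The branch of `log (wᵗ z + d)`. -/
  logDen : C(Ball n, ℂ)
  exp_logDen : ∀ z : Ball n, Complex.exp (logDen z) = den base z

instance (n : ℕ) : Mul (Cover n) where
  mul g h :=
    { base := g.base * h.base
      logDen := ⟨fun z => g.logDen (h.base • z) + h.logDen z,
        (g.logDen.continuous.comp (continuous_smul_ball h.base)).add h.logDen.continuous⟩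
      exp_logDen := fun z => by
        simp only [ContinuousMap.coe_mk]
        rw [Complex.exp_add, g.exp_logDen, h.exp_logDen, den_mul] }

instance (n : ℕ) : One (Cover n) where
  one :=
    { base := 1
      logDen := ⟨fun _ => 0, continuous_const⟩
      exp_logDen := fun z => by simp [(one_aux z.2).1] }

instance (n : ℕ) : Inv (Cover n) where
  inv g :=
    { base := g.base⁻¹
      logDen := ⟨fun z => -g.logDen (g.base⁻¹ • z),
        (g.logDen.continuous.comp (continuous_smul_ball g.base⁻¹)).neg⟩
      exp_logDen := fun z => by
        simp only [ContinuousMap.coe_mk]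
        rw [Complex.exp_neg, g.exp_logDen]
        have h := den_mul g.base g.base⁻¹ z
        rw [mul_inv_cancel, (one_aux z.2).1] at h
        exact (eq_inv_of_mul_eq_one_right h.symm).symm }

theorem Cover.base_mul {n : ℕ} (g h : Cover n) : (g * h).base = g.base * h.base := rfl
theorem Cover.base_one {n : ℕ} : (1 : Cover n).base = 1 := rfl
theorem Cover.base_inv {n : ℕ} (g : Cover n) : g⁻¹.base = g.base⁻¹ := rfl
theorem Cover.logDen_mul {n : ℕ} (g h : Cover n) (z : Ball n) :
    (g * h).logDen z = g.logDen (h.base • z) + h.logDen z := rfl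
theorem Cover.logDen_one {n : ℕ} (z : Ball n) : (1 : Cover n).logDen z = 0 := rfl
theorem Cover.logDen_inv {n : ℕ} (g : Cover n) (z : Ball n) :
    g⁻¹.logDen z = -g.logDen (g.base⁻¹ • z) := rfl

instance (n : ℕ) : Group (Cover n) where
  mul_assoc f g h := by
    refine Cover.ext (mul_assoc _ _ _) (ContinuousMap.ext fun z => ?_)
    simp only [Cover.logDen_mul, Cover.base_mul, mul_smul, add_assoc]
  one_mul g := by
    refine Cover.ext (one_mul _) (ContinuousMap.ext fun z => ?_)
    simp only [Cover.logDen_mul, Cover.logDen_one, zero_add]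
  mul_one g := by
    refine Cover.ext (mul_one _) (ContinuousMap.ext fun z => ?_)
    simp only [Cover.logDen_mul, Cover.logDen_one, Cover.base_one, one_smul, add_zero]
  inv_mul_cancel g := by
    refine Cover.ext (inv_mul_cancel _) (ContinuousMap.ext fun z => ?_)
    simp only [Cover.logDen_mul, Cover.logDen_one, Cover.logDen_inv, inv_smul_smul,
      neg_add_cancel]

/-- The covering homomorphism onto `SU(n,1)`. -/
def Cover.proj (n : ℕ) : Cover n →* SU n where
  toFun := Cover.base
  map_one' := rfl
  map_mul' _ _ := rfl

/-- The covering group acts on the ball through the covering homomorphism. -/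
instance (n : ℕ) : MulAction (Cover n) (Ball n) := MulAction.compHom (Ball n) (Cover.proj n)

theorem Cover.smul_def {n : ℕ} (g : Cover n) (z : Ball n) : g • z = g.base • z := rfl

/-- The factor of automorphy `j_lam(g, z) = (wᵗ z + d) ^ (-lam)` on the covering group. -/
def autj {n : ℕ} (lam : ℝ) (g : Cover n) (z : Ball n) : ℂ :=
  Complex.exp (-(lam : ℂ) * g.logDen z)

/-- The centre of the ball. -/
def ballZero (n : ℕ) : Ball n := ⟨0, by simp⟩

/-- An element of the covering group is determined by its matrix and the value at `0` of its branch
of the logarithm; this gives the covering group its topology. -/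
def Cover.toProd {n : ℕ} (g : Cover n) : Matrix (Fin n ⊕ Unit) (Fin n ⊕ Unit) ℂ × ℂ :=
  ((mat g.base), g.logDen (ballZero n))

instance (n : ℕ) : TopologicalSpace (Cover n) :=
  TopologicalSpace.induced Cover.toProd inferInstance

instance (n : ℕ) : MeasurableSpace (Cover n) := borel _

instance (n : ℕ) : BorelSpace (Cover n) := ⟨rfl⟩

theorem one_add_mem_slitPlane {n : ℕ} (A : SU n) (z : Ball n) :
    1 + (den A z - den A 0) / den A 0 ∈ Complex.slitPlane := by
  have hd0 : den A 0 ≠ 0 := den_ne_zero A (by simp)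
  by_contra hx
  rw [Complex.mem_slitPlane_iff, not_or, not_lt, not_not] at hx
  set x : ℂ := (den A z - den A 0) / den A 0 with hxdef
  have him : x.im = 0 := by simpa using hx.2
  have hre : x.re ≤ -1 := by
    have := hx.1
    simp only [Complex.add_re, Complex.one_re] at this
    linarith
  have hxr : x = (x.re : ℂ) := by
    apply Complex.ext <;> simp [him]
  have hxne : (x.re : ℂ) ≠ 0 := by
    intro h
    have : x.re = 0 := by exact_mod_cast h
    linarith
  set t : ℂ := -((x.re : ℂ))⁻¹ with ht
  have htn : ‖t‖ ≤ 1 := by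
    rw [ht, norm_neg, norm_inv, Complex.norm_real, Real.norm_eq_abs]
    refine inv_le_one_of_one_le₀ ?_
    rw [abs_of_neg (by linarith)]
    linarith
  have htz : t • (z : Cn n) ∈ ball (0 : Cn n) 1 := by
    rw [mem_ball_zero_iff, norm_smul]
    have h1 : ‖(z : Cn n)‖ < 1 := mem_ball_zero_iff.1 z.2
    have h2 := norm_nonneg (z : Cn n)
    nlinarith
  refine den_ne_zero A htz ?_
  have hlin : den A (t • (z : Cn n)) = den A 0 + t * (den A z - den A 0) := by
    simp only [den, PiLp.smul_apply, smul_eq_mul, PiLp.zero_apply, mul_zero,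
      Finset.sum_const_zero, zero_add, add_sub_cancel_right, Finset.mul_sum]
    rw [add_comm]
    congr 1
    exact Finset.sum_congr rfl fun i _ => by ring
  have h3 : den A z - den A 0 = (x.re : ℂ) * den A 0 := by
    rw [← hxr, hxdef]
    field_simp
  rw [hlin, h3, ht]
  field_simp
  ring

/-- Every pair of a matrix in `SU(n,1)` and a logarithm of its last entry lifts to the cover. -/
theorem Cover.exists_lift {n : ℕ} (A : SU n) {s : ℂ} (hs : Complex.exp s = den A 0) :
    ∃ g : Cover n, g.base = A ∧ g.logDen (ballZero n) = s := by
  have hd0 : den A 0 ≠ 0 := den_ne_zero A (by simp)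
  refine ⟨⟨A, ⟨fun z => s + Complex.log (1 + (den A z - den A 0) / den A 0), ?_⟩, ?_⟩, rfl, ?_⟩
  · have := continuous_den A
    refine continuous_const.add (Continuous.clog ?_ fun z => one_add_mem_slitPlane A z)
    fun_prop
  · intro z
    simp only [ContinuousMap.coe_mk]
    rw [Complex.exp_add, hs, Complex.exp_log
      (Complex.slitPlane_ne_zero (one_add_mem_slitPlane A z))]
    field_simp
    ring
  · simp [ballZero]

theorem Cover.logDen_eq {n : ℕ} {g : Cover n} (z : Ball n) :
    g.logDen z = g.logDen (ballZero n) +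
      Complex.log (1 + (den g.base z - den g.base 0) / den g.base 0) := by
  have hd0 : den g.base 0 ≠ 0 := den_ne_zero g.base (by simp)
  have hs : Complex.exp (g.logDen (ballZero n)) = den g.base 0 := g.exp_logDen _
  set u : Ball n → ℂ := fun z => g.logDen z - (g.logDen (ballZero n) +
      Complex.log (1 + (den g.base z - den g.base 0) / den g.base 0)) with hu
  have huc : Continuous u := by
    have := continuous_den g.base
    refine g.logDen.continuous.sub (continuous_const.add (Continuous.clog ?_ fun z =>
      one_add_mem_slitPlane g.base z))
    fun_prop
  have hexp : ∀ z, Complex.exp (u z) = 1 := by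
    intro z
    rw [hu]
    simp only
    rw [Complex.exp_sub, Complex.exp_add, hs, Complex.exp_log
      (Complex.slitPlane_ne_zero (one_add_mem_slitPlane g.base z)), g.exp_logDen]
    have := den_ne_zero g.base z.2
    field_simp
    rw [add_sub_cancel, div_self this]
  have hint : ∀ z, ∃ k : ℤ, u z = k * (2 * Real.pi * Complex.I) :=
    fun z => Complex.exp_eq_one_iff.1 (hexp z)
  choose k hk using hint
  have hkr : ∀ z, (k z : ℝ) = (u z).im / (2 * Real.pi) := by
    intro z
    rw [hk z]
    simp
  have hkc : Continuous k := by
    rw [Int.isClosedEmbedding_coe_real.isEmbedding.continuous_iff]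
    have : (Int.cast : ℤ → ℝ) ∘ k = fun z => (u z).im / (2 * Real.pi) := funext hkr
    rw [this]
    fun_prop
  have hconn : PreconnectedSpace (Ball n) :=
    Subtype.preconnectedSpace (convex_ball (0 : Cn n) 1).isPreconnected
  have hconst : k z = k (ballZero n) := PreconnectedSpace.constant hconn hkc
  have h0 : u (ballZero n) = 0 := by simp [hu, ballZero]
  have hz : u z = 0 := by rw [hk z, hconst, ← hk, h0]
  rw [hu] at hz
  exact sub_eq_zero.1 hz

theorem Cover.toProd_injective {n : ℕ} : Function.Injective (Cover.toProd (n := n)) := by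
  intro g h hgh
  have h1 : g.base = h.base := mat_injective (congrArg Prod.fst hgh)
  have h2 : g.logDen (ballZero n) = h.logDen (ballZero n) := congrArg Prod.snd hgh
  refine Cover.ext h1 (ContinuousMap.ext fun z => ?_)
  rw [Cover.logDen_eq, Cover.logDen_eq (g := h), h1, h2]

theorem den_zero {n : ℕ} (A : SU n) : den A 0 = (mat A) (Sum.inr ()) (Sum.inr ()) := by
  simp [den]

theorem Cover.isClosedEmbedding_toProd (n : ℕ) :
    Topology.IsClosedEmbedding (Cover.toProd (n := n)) := by
  refine ⟨⟨⟨rfl⟩, Cover.toProd_injective⟩, ?_⟩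
  have hr : Set.range (Cover.toProd (n := n)) =
      {p | p.1.det = 1 ∧ p.1 * J n * p.1ᴴ = J n ∧
        Complex.exp p.2 = p.1 (Sum.inr ()) (Sum.inr ())} := by
    ext ⟨M, s⟩
    constructor
    · rintro ⟨g, hg⟩
      obtain ⟨rfl, rfl⟩ : mat g.base = M ∧ g.logDen (ballZero n) = s := Prod.mk.inj hg
      refine ⟨g.base.1.2, g.base.2, ?_⟩
      have := g.exp_logDen (ballZero n)
      rwa [ballZero, den_zero] at this
    · rintro ⟨h1, h2, h3⟩
      obtain ⟨g, hg1, hg2⟩ := Cover.exists_lift (⟨⟨M, h1⟩, h2⟩ : SU n) (s := s)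
        (by rw [den_zero]; exact h3)
      refine ⟨g, Prod.ext ?_ hg2⟩
      simp [Cover.toProd, hg1, mat]
  rw [hr]
  refine IsClosed.and (isClosed_eq ?_ continuous_const)
    (IsClosed.and (isClosed_eq ?_ continuous_const) (isClosed_eq ?_ ?_))
  · exact continuous_fst.matrix_det
  · exact (continuous_fst.matrix_mul continuous_const).matrix_mul
      continuous_fst.matrix_conjTranspose
  · fun_prop
  · exact continuous_fst.matrix_elem _ _

instance (n : ℕ) : PolishSpace (Cover n) := by
  have : PolishSpace (Matrix (Fin n ⊕ Unit) (Fin n ⊕ Unit) ℂ) :=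
    inferInstanceAs (PolishSpace (Fin n ⊕ Unit → Fin n ⊕ Unit → ℂ))
  exact (Cover.isClosedEmbedding_toProd n).polishSpace

theorem Cover.continuous_mat (n : ℕ) : Continuous fun g : Cover n => (mat g.base) :=
  continuous_fst.comp (continuous_induced_dom (f := Cover.toProd (n := n)))

theorem Cover.continuous_proj (n : ℕ) : Continuous (Cover.proj n) :=
  Continuous.subtype_mk (Continuous.subtype_mk (Cover.continuous_mat n) _) _

theorem Cover.continuous_smul_left {n : ℕ} (z : Ball n) : Continuous fun g : Cover n => g • z := by
  have h := fun i j => (Cover.continuous_mat n).matrix_elem i j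
  refine Continuous.subtype_mk ?_ _
  refine (PiLp.continuous_toLp 2 _).comp (continuous_pi fun i => ?_)
  refine Continuous.div ?_ ?_ fun g => den_ne_zero g.base z.2
  · exact (continuous_finsetSum _ fun k _ => (h _ _).mul continuous_const).add (h _ _)
  · exact (continuous_finsetSum _ fun k _ => (h _ _).mul continuous_const).add (h _ _)

/-! ### Sections over an orbit and the restriction operator -/

section Orbit

variable {n : ℕ} (lam : ℝ) (H : ClosedSubgroup (SU n)) (z₀ : Ball n)

/-- The inverse image of `H` in the covering group. -/
abbrev Htilde : Subgroup (Cover n) := H.toSubgroup.comap (Cover.proj n)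

/-- The orbit `M = H · z₀`. -/
abbrev Orb : Set (Ball n) := MulAction.orbit H.toSubgroup z₀

/-- The orbit map from the covering group. -/
def orbMap (h : Htilde H) : Orb H z₀ := ⟨h • z₀, ⟨⟨h.1.base, h.2⟩, rfl⟩⟩

theorem orbMap_surjective : Function.Surjective (orbMap H z₀) := by
  rintro ⟨_, ⟨⟨A, hA⟩, rfl⟩⟩
  have hd0 : den A 0 ≠ 0 := den_ne_zero A (by simp)
  obtain ⟨g, hg, -⟩ := Cover.exists_lift A (Complex.exp_log hd0)
  have hgH : g ∈ Htilde H := by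
    change g.base ∈ H.toSubgroup
    rw [hg]
    exact hA
  refine ⟨⟨g, hgH⟩, Subtype.ext ?_⟩
  change g.base • z₀ = A • z₀
  rw [hg]

/-- A choice, for every point `m` of the orbit, of some `h` in the covering group with
`h · z₀ = m`. It is used to integrate over the orbit functions of `h` that depend on `h · z₀`
only. -/
def liftPt (m : Orb H z₀) : Htilde H := Classical.choose (orbMap_surjective H z₀ m)

theorem orbMap_liftPt (m : Orb H z₀) : orbMap H z₀ (liftPt H z₀ m) = m :=
  Classical.choose_spec (orbMap_surjective H z₀ m)

/-- The character `χ_lam(k) = j_lam(k, z₀)⁻¹` of the isotropy group of `z₀`. -/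
def chi (k : Htilde H) : ℂ := (autj lam (k : Cover n) z₀)⁻¹

/-- The covariance `f (h k) = χ_lam(k)⁻¹ f(h)` for `k` in the isotropy group of `z₀`. -/
def Covariant (f : Htilde H → ℂ) : Prop :=
  ∀ h k : Htilde H, k • z₀ = z₀ → f (h * k) = (chi lam H z₀ k)⁻¹ * f h

/-- Functions on the covering group that depend on `h · z₀` only. -/
def RightInvariant (F : Htilde H → ℂ) : Prop :=
  ∀ h k : Htilde H, k • z₀ = z₀ → F (h * k) = F h

variable {lam H z₀}

theorem continuous_orbMap : Continuous (orbMap H z₀) :=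
  Continuous.subtype_mk ((Cover.continuous_smul_left z₀).comp continuous_subtype_val) _

instance : PolishSpace (Htilde H) := by
  refine IsClosed.polishSpace (s := (Htilde H : Set (Cover n))) ?_
  exact H.isClosed'.preimage (Cover.continuous_proj n)

theorem RightInvariant.apply_liftPt {F : Htilde H → ℂ} (hF : RightInvariant H z₀ F) (h : Htilde H) :
    F (liftPt H z₀ (orbMap H z₀ h)) = F h := by
  set g := liftPt H z₀ (orbMap H z₀ h) with hg
  have h1 : g • z₀ = h • z₀ := congrArg Subtype.val (orbMap_liftPt H z₀ (orbMap H z₀ h))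
  have h2 : (h⁻¹ * g) • z₀ = z₀ := by rw [mul_smul, h1, inv_smul_smul]
  have h3 := hF h (h⁻¹ * g) h2
  rwa [mul_inv_cancel_left] at h3

/-- A measurable right invariant function descends to a measurable function on the orbit. -/
theorem RightInvariant.measurable {F : Htilde H → ℂ} (hF : RightInvariant H z₀ F)
    (hm : Measurable F) : Measurable fun m : Orb H z₀ => F (liftPt H z₀ m) := by
  intro U hU
  have hq : Measurable (orbMap H z₀) := continuous_orbMap.measurable
  rw [← hq.measurableSet_preimage_iff_of_surjective (orbMap_surjective H z₀)]
  have : orbMap H z₀ ⁻¹' ((fun m : Orb H z₀ => F (liftPt H z₀ m)) ⁻¹' U) = F ⁻¹' U := by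
    ext h
    simp only [Set.mem_preimage, hF.apply_liftPt]
  rw [this]
  exact hm hU

theorem norm_chi {k : Htilde H} (hk : k • z₀ = z₀) : ‖chi lam H z₀ k‖ = 1 := by
  have hz : ‖(z₀ : Cn n)‖ < 1 := mem_ball_zero_iff.1 z₀.2
  have h1 := norm_den_sq_mul (k : Cover n).base z₀.2
  have h2 : moebius (k : Cover n).base z₀ = z₀ := congrArg Subtype.val hk
  rw [h2] at h1
  have h3 : (1 : ℝ) - ‖(z₀ : Cn n)‖ ^ 2 ≠ 0 := by
    have := norm_nonneg (z₀ : Cn n)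
    nlinarith
  have h4 : ‖den (k : Cover n).base z₀‖ ^ 2 = 1 := by
    have := mul_right_cancel₀ h3 (h1.trans (one_mul _).symm)
    exact this
  have h5 : ‖den (k : Cover n).base z₀‖ = 1 := by
    have := norm_nonneg (den (k : Cover n).base z₀)
    nlinarith
  rw [← (k : Cover n).exp_logDen, Complex.norm_exp, Real.exp_eq_one_iff] at h5
  rw [chi, norm_inv, autj, Complex.norm_exp]
  simp [h5]

theorem Covariant.conj_mul {f g : Htilde H → ℂ} (hf : Covariant lam H z₀ f)
    (hg : Covariant lam H z₀ g) : RightInvariant H z₀ fun h => conj (f h) * g h := by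
  intro h k hk
  have h1 : conj (chi lam H z₀ k)⁻¹ * (chi lam H z₀ k)⁻¹ = 1 := by
    rw [mul_comm, Complex.mul_conj, Complex.normSq_eq_norm_sq, norm_inv, norm_chi hk]
    norm_num
  simp only [hf h k hk, hg h k hk, map_mul]
  calc _ = (conj (chi lam H z₀ k)⁻¹ * (chi lam H z₀ k)⁻¹) * (conj (f h) * g h) := by ring
    _ = _ := by rw [h1, one_mul]

theorem measurable_conj_mul {f g : Htilde H → ℂ} (hf : Covariant lam H z₀ f)
    (hg : Covariant lam H z₀ g) (hfm : Measurable f) (hgm : Measurable g) :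
    Measurable fun m : Orb H z₀ => conj (f (liftPt H z₀ m)) * g (liftPt H z₀ m) :=
  (hf.conj_mul hg).measurable ((Complex.continuous_conj.measurable.comp hfm).mul hgm)

variable (lam) (μ : Measure (Orb H z₀))

/-- The measurable functions on the covering group with the covariance prescribed by `χ_lam` and
with `∫_M |f|² dμ < ∞`. -/
def sections : Submodule ℂ (Htilde H → ℂ) where
  carrier := {f | Measurable f ∧ Covariant lam H z₀ f ∧
    Integrable (fun m : Orb H z₀ => ‖f (liftPt H z₀ m)‖ ^ 2) μ}
  zero_mem' := ⟨measurable_const, fun h k _ => by simp, by simp⟩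
  add_mem' := by
    rintro f g ⟨hf1, hf2, hf3⟩ ⟨hg1, hg2, hg3⟩
    have hc : Covariant lam H z₀ (f + g) := fun h k hk => by
      simp only [Pi.add_apply, hf2 h k hk, hg2 h k hk, mul_add]
    refine ⟨hf1.add hg1, hc, ?_⟩
    have hm := (measurable_conj_mul hc hc (hf1.add hg1) (hf1.add hg1)).norm
    have heq : (fun m : Orb H z₀ => ‖(f + g) (liftPt H z₀ m)‖ ^ 2) =
        fun m => ‖conj ((f + g) (liftPt H z₀ m)) * (f + g) (liftPt H z₀ m)‖ := by
      ext m
      rw [norm_mul, RCLike.norm_conj, sq]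
    refine Integrable.mono' ((hf3.const_mul 2).add (hg3.const_mul 2)) ?_ ?_
    · rw [heq]
      exact hm.aestronglyMeasurable
    · refine Filter.Eventually.of_forall fun m => ?_
      rw [Real.norm_of_nonneg (by positivity)]
      simp only [Pi.add_apply]
      have h1 := norm_add_le (f (liftPt H z₀ m)) (g (liftPt H z₀ m))
      have h2 := norm_nonneg (f (liftPt H z₀ m) + g (liftPt H z₀ m))
      nlinarith [sq_nonneg (‖f (liftPt H z₀ m)‖ - ‖g (liftPt H z₀ m)‖)]
  smul_mem' := by
    rintro c f ⟨hf1, hf2, hf3⟩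
    refine ⟨hf1.const_smul c, fun h k hk => ?_, ?_⟩
    · simp only [Pi.smul_apply, hf2 h k hk, smul_eq_mul]
      ring
    · have : (fun m : Orb H z₀ => ‖(c • f) (liftPt H z₀ m)‖ ^ 2) =
          fun m => ‖c‖ ^ 2 * ‖f (liftPt H z₀ m)‖ ^ 2 := by
        ext m
        simp [mul_pow]
      rw [this]
      exact hf3.const_mul _

/-- The space of square integrable covariant functions, with the seminorm of `L²_χ(M, μ)`. -/
def SectionSpace : Type := sections lam μ

instance : AddCommGroup (SectionSpace lam μ) := inferInstanceAs (AddCommGroup (sections lam μ))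

instance : Module ℂ (SectionSpace lam μ) := inferInstanceAs (Module ℂ (sections lam μ))

variable {lam μ}

/-- The function on the covering group underlying an element of `SectionSpace`. -/
def SectionSpace.fn (f : SectionSpace lam μ) : Htilde H → ℂ := f.1

/-- The element of `SectionSpace` given by a function. -/
def SectionSpace.of (f : Htilde H → ℂ) (hf : f ∈ sections lam μ) : SectionSpace lam μ := ⟨f, hf⟩

theorem SectionSpace.integrable_conj_mul (f g : SectionSpace lam μ) :
    Integrable (fun m : Orb H z₀ => conj (f.fn (liftPt H z₀ m)) * g.fn (liftPt H z₀ m)) μ := by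
  refine Integrable.mono' (f.2.2.2.add g.2.2.2)
    (measurable_conj_mul f.2.2.1 g.2.2.1 f.2.1 g.2.1).aestronglyMeasurable ?_
  refine Filter.Eventually.of_forall fun m => ?_
  rw [norm_mul, RCLike.norm_conj]
  simp only [Pi.add_apply, SectionSpace.fn]
  nlinarith [sq_nonneg (‖f.1 (liftPt H z₀ m)‖ - ‖g.1 (liftPt H z₀ m)‖),
    sq_nonneg ‖f.1 (liftPt H z₀ m)‖, sq_nonneg ‖g.1 (liftPt H z₀ m)‖]

/-- The inner product `∫_M f̄ g dμ` of covariant functions. -/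
@[reducible]
def sectionCore (lam : ℝ) (μ : Measure (Orb H z₀)) :
    PreInnerProductSpace.Core ℂ (SectionSpace lam μ) where
  inner f g := ∫ m, conj (f.fn (liftPt H z₀ m)) * g.fn (liftPt H z₀ m) ∂μ
  conj_inner_symm f g := by
    rw [← integral_conj]
    simp [mul_comm]
  re_inner_nonneg f := by
    have : (∫ m, conj (f.fn (liftPt H z₀ m)) * f.fn (liftPt H z₀ m) ∂μ) =
        ((∫ m, ‖f.fn (liftPt H z₀ m)‖ ^ 2 ∂μ : ℝ) : ℂ) := by
      rw [← integral_complex_ofReal]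
      simp [Complex.conj_mul']
    rw [this]
    exact integral_nonneg fun m => by positivity
  add_left f g h := by
    rw [← integral_add (f.integrable_conj_mul h) (g.integrable_conj_mul h)]
    refine integral_congr_ae (Filter.Eventually.of_forall fun m => ?_)
    change conj (f.fn (liftPt H z₀ m) + g.fn (liftPt H z₀ m)) * _ = _
    rw [map_add, add_mul]
  smul_left f g c := by
    rw [← integral_const_mul]
    refine integral_congr_ae (Filter.Eventually.of_forall fun m => ?_)
    change conj (c * f.fn (liftPt H z₀ m)) * _ = _
    rw [map_mul, mul_assoc]

instance : SeminormedAddCommGroup (SectionSpace lam μ) :=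
  InnerProductSpace.Core.toSeminormedAddCommGroup (c := sectionCore lam μ)

instance : InnerProductSpace ℂ (SectionSpace lam μ) :=
  InnerProductSpace.ofCore (sectionCore lam μ)

variable (lam μ)

/-- The inner product space `L²_χ(M, μ)`: covariant functions modulo equality almost everywhere. -/
abbrev L2chi : Type := SeparationQuotient (SectionSpace lam μ)

variable {lam μ}

/-- The class in `L²_χ(M, μ)` of a covariant square integrable function. -/
def L2chi.mk (f : Htilde H → ℂ) (hf : f ∈ sections lam μ) : L2chi lam μ :=
  SeparationQuotient.mk (SectionSpace.of f hf)

variable (lam H z₀)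

/-- The function `R f (h) = j_lam(h, z₀) f(h · z₀)` on the covering group. -/
def restrictFun [Fact ((n : ℝ) < lam)] : Bergman n lam →ₗ[ℂ] (Htilde H → ℂ) where
  toFun f h := autj lam (h : Cover n) z₀ * hol f (h • z₀ : Ball n)
  map_add' f g := by
    ext h
    simp only [Pi.add_apply]
    rw [hol_add f g (h • z₀ : Ball n).2, mul_add]
  map_smul' c f := by
    ext h
    simp only [Pi.smul_apply, smul_eq_mul, RingHom.id_apply]
    rw [hol_smul c f (h • z₀ : Ball n).2]
    ring

variable {H z₀} (μ)

/-- The restriction operator `R` from the Bergman space to `L²_χ(M, μ)`, defined on the space of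
all `f` for which `R f` is square integrable. -/
def restrictOp [Fact ((n : ℝ) < lam)] : Bergman n lam →ₗ.[ℂ] L2chi lam μ where
  domain := (sections lam μ).comap (restrictFun lam H z₀)
  toFun :=
    { toFun := fun f => L2chi.mk (restrictFun lam H z₀ f) f.2
      map_add' := fun f g => by
        have h : SectionSpace.of (restrictFun lam H z₀ (f + g).1) (f + g).2 =
            SectionSpace.of (restrictFun lam H z₀ f.1) f.2 +
              SectionSpace.of (restrictFun lam H z₀ g.1) g.2 :=
          Subtype.ext (map_add (restrictFun lam H z₀) f.1 g.1)
        exact (congrArg SeparationQuotient.mk h).trans (SeparationQuotient.mk_add _ _)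
      map_smul' := fun c f => by
        have h : SectionSpace.of (restrictFun lam H z₀ (c • f).1) (c • f).2 =
            c • SectionSpace.of (restrictFun lam H z₀ f.1) f.2 :=
          Subtype.ext (map_smul (restrictFun lam H z₀) c f.1)
        exact (congrArg SeparationQuotient.mk h).trans (SeparationQuotient.mk_smul _ _) }

/-- The closure `𝓑_lam` of the range of the restriction operator. -/
def rangeClosure [Fact ((n : ℝ) < lam)] : Submodule ℂ (L2chi lam μ) :=
  (LinearMap.range (restrictOp lam μ).toFun).topologicalClosure

/-- The convolution `(f * ν)(h) = ∫_{H/H_{z₀}} f(k) ν(k⁻¹ h) dμ(k)`. -/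
def convol (f ν : Htilde H → ℂ) (h : Htilde H) : ℂ :=
  ∫ m, f (liftPt H z₀ m) * ν ((liftPt H z₀ m)⁻¹ * h) ∂μ

variable (H z₀)

/-- The kernel `ν_φ(h) = j_lam(h, z₀) ⟨φ K_{z₀}, K_{h · z₀}⟩`, a function on the covering group. -/
def nu [Fact ((n : ℝ) < lam)] (φ : Lp ℂ ∞ (bergmanMeasure n lam)) (h : Htilde H) : ℂ :=
  autj lam (h : Cover n) z₀ *
    inner ℂ (kernelAt n lam (h • z₀) : L2 n lam) (φ • (kernelAt n lam z₀ : L2 n lam) : L2 n lam)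

/-- The orbit `H · z₀` is restriction injective: holomorphic functions on the ball are determined
by their restrictions to it. -/
def RestrictionInjective : Prop :=
  ∀ F G : Cn n → ℂ, DifferentiableOn ℂ F (ball 0 1) → DifferentiableOn ℂ G (ball 0 1) →
    (∀ m ∈ Orb H z₀, F m = G m) → ∀ z ∈ ball (0 : Cn n) 1, F z = G z

end Orbit

end

end BallToeplitz

open BallToeplitz

namespace BallToeplitz

noncomputable section

/-! ### The Jacobian of a Möbius transformation -/

/-! Two facts carry the theorem: `R` is everywhere defined and bounded, and the reproducing kernels
transform covariantly under the group. Below, ⟨·,·⟩ is conjugate linear in its first variable, as in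
the code.

The formula. The operators f ↦ j(g,·) f(g·) are unitary on the Bergman space, because the Jacobian
|wᵗz+d|^(-2(n+1)) and the transformed weight combine to |j|². They send K_{g·w} to a multiple of K_w
and, for g over `H`, commute with multiplication by φ. Hence ν_φ(k⁻¹h) = j(h,z₀) conj(j(k,z₀))
⟨K_{h·z₀}, φ K_{k·z₀}⟩ (`nu_inv_mul`). Let u be the Riesz vector with ⟨u, ·⟩ = ⟨K_{h·z₀}, φ ·⟩. Then
f(k) ν_φ(k⁻¹h) = j(h,z₀) conj(Ru(k)) f(k) (`mul_nu_eq`). This integrand descends to M and is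
integrable, and its integral is j(h,z₀)⟨Ru, f⟩ = j(h,z₀)⟨u, R*f⟩ = j(h,z₀)⟨K_{h·z₀}, φ R*f⟩, which
is the value of R T_φ R*f at h.

The bound (`exists_lintegral_restrictFun_le`). A mean value inequality at z₀, transported by the
group, bounds |Rf(h)|² by a constant times the integral of |f|² over the points near h·z₀ in the
invariant distance, uniformly in h. After integration over M and Tonelli's theorem, it remains to
bound, uniformly in z, the μ-measure of the orbit points near z. If A·z₀ is one such point, a
quasi-triangle inequality puts all of them near A·z₀, and A⁻¹ moves them, preserving μ, into a fixed
neighbourhood of z₀. That neighbourhood has finite measure, since |j(h,z₀)|² is integrable over M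
and bounded below there. -/

/-- The complex Jacobian matrix of `moebius A` at `z`. -/
def moebiusJacobian {n : ℕ} (A : SU n) (z : Cn n) : Matrix (Fin n) (Fin n) ℂ :=
  (den A z)⁻¹ • ((mat A).toBlocks₁₁ -
    Matrix.of fun i k => moebius A z i * (mat A) (Sum.inr ()) (Sum.inl k))

theorem hasFDerivAt_linear_form {n : ℕ} (c : Fin n → ℂ) (b : ℂ) (z : Cn n) :
    HasFDerivAt (fun z : Cn n => ∑ k, c k * z k + b)
      (∑ k, c k • (EuclideanSpace.proj k : Cn n →L[ℂ] ℂ)) z := by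
  have h : HasFDerivAt (fun z : Cn n => (∑ k, c k • (EuclideanSpace.proj k : Cn n →L[ℂ] ℂ)) z + b)
      (∑ k, c k • (EuclideanSpace.proj k : Cn n →L[ℂ] ℂ)) z :=
    (ContinuousLinearMap.hasFDerivAt _).add_const b
  simpa using h

theorem hasFDerivAt_den {n : ℕ} (A : SU n) (z : Cn n) :
    HasFDerivAt (den A) (∑ k, (mat A) (Sum.inr ()) (Sum.inl k) •
      (EuclideanSpace.proj k : Cn n →L[ℂ] ℂ)) z :=
  hasFDerivAt_linear_form _ _ z

/-- The quotient rule: if m is the map and N = d·m its affine numerator, then dm = (dN - m dd)/d,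
and dd is the row wᵗ. -/
theorem hasFDerivAt_moebius {n : ℕ} (A : SU n) {z : Cn n} (hz : z ∈ ball (0 : Cn n) 1) :
    HasFDerivAt (moebius A)
      (LinearMap.toContinuousLinearMap (Matrix.toEuclideanLin (moebiusJacobian A z))) z := by
  have hd0 := den_ne_zero A hz
  rw [← hasFDerivWithinAt_univ, hasFDerivWithinAt_euclidean]
  intro i
  rw [hasFDerivWithinAt_univ]
  have h1 := hasFDerivAt_linear_form (fun k => (mat A) (Sum.inl i) (Sum.inl k))
    ((mat A) (Sum.inl i) (Sum.inr ())) z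
  have h2 := (hasDerivAt_inv hd0).comp_hasFDerivAt z (hasFDerivAt_den A z)
  have h3 := h1.mul h2
  refine (h3.congr_fderiv ?_).congr_of_eventuallyEq (Filter.Eventually.of_forall fun w => ?_)
  · ext u
    simp [moebiusJacobian, Matrix.mulVec, dotProduct, Finset.mul_sum, moebius, Matrix.toBlocks₁₁]
    rw [add_comm, ← sub_eq_add_neg, ← Finset.sum_sub_distrib]
    refine Finset.sum_congr rfl fun k _ => ?_
    field_simp
  · simp [moebius, div_eq_mul_inv]

/-- Multiplying A by the unipotent matrix with last column (z, 1) does not change its determinant 1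
and makes its last column d·(m, 1), where m is the image of z. The Schur complement of the corner d
is then a - m wᵗ, so this matrix has determinant d⁻¹; the scalar factor of the Jacobian contributes
the remaining d⁻ⁿ. -/
theorem det_moebiusJacobian {n : ℕ} (A : SU n) {z : Cn n} (hz : z ∈ ball (0 : Cn n) 1) :
    (moebiusJacobian A z).det = ((den A z)⁻¹) ^ (n + 1) := by
  have hd0 := den_ne_zero A hz
  rw [moebiusJacobian, Matrix.det_smul, Fintype.card_fin, pow_succ]
  congr 1
  set V : Matrix (Fin n) Unit ℂ := Matrix.of fun i _ => z i with hV
  set W : Matrix Unit (Fin n) ℂ := (mat A).toBlocks₂₁ with hW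
  have hprod : mat A * Matrix.fromBlocks 1 V 0 1 = Matrix.fromBlocks (mat A).toBlocks₁₁
      (Matrix.of fun i _ => den A z * moebius A z i) W (Matrix.of fun _ _ => den A z) := by
    conv_lhs => rw [← Matrix.fromBlocks_toBlocks (mat A)]
    rw [Matrix.fromBlocks_multiply]
    congr 1
    · simp
    · ext i j
      simp [hV, Matrix.mul_apply, moebius, Matrix.toBlocks₁₁, Matrix.toBlocks₁₂]
      field_simp
    · simp [hW]
    · ext i j
      simp [hV, Matrix.mul_apply, den, Matrix.toBlocks₂₁, Matrix.toBlocks₂₂]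
  have hdet : (mat A * Matrix.fromBlocks 1 V 0 1).det = 1 := by
    have hA : (mat A).det = 1 := A.1.2
    simp [Matrix.det_mul, hA]
  have hinv : (Matrix.of fun _ _ => den A z : Matrix Unit Unit ℂ) *
      (Matrix.of fun _ _ => (den A z)⁻¹) = 1 := by
    ext i j
    simp [Matrix.mul_apply, hd0]
  have : Invertible (Matrix.of fun _ _ => den A z : Matrix Unit Unit ℂ) :=
    ⟨_, mul_eq_one_comm.1 hinv, hinv⟩
  have hinvOf : ⅟(Matrix.of fun _ _ => den A z : Matrix Unit Unit ℂ) =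
      Matrix.of fun _ _ => (den A z)⁻¹ := invOf_eq_right_inv hinv
  rw [hprod, Matrix.det_fromBlocks₂₂, hinvOf] at hdet
  have hD : (Matrix.of fun _ _ => den A z : Matrix Unit Unit ℂ).det = den A z := by
    simp
  rw [hD] at hdet
  refine eq_inv_of_mul_eq_one_right ?_
  convert hdet using 3
  ext i k
  simp only [Matrix.sub_apply, Matrix.mul_apply, hW, Matrix.toBlocks₂₁, Matrix.of_apply,
    Finset.univ_unique, Finset.sum_singleton]
  field_simp

/-- The real determinant of a complex linear map is the squared modulus of its complex determinant,
which doubles the exponent. -/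
theorem abs_det_fderiv_moebius {n : ℕ} (A : SU n) {z : Cn n} (hz : z ∈ ball (0 : Cn n) 1) :
    |((LinearMap.toContinuousLinearMap
      (Matrix.toEuclideanLin (moebiusJacobian A z))).restrictScalars ℝ).det| =
      ‖den A z‖⁻¹ ^ (2 * (n + 1)) := by
  have h1 : ((LinearMap.toContinuousLinearMap
      (Matrix.toEuclideanLin (moebiusJacobian A z))).restrictScalars ℝ).det =
      LinearMap.det ((Matrix.toEuclideanLin (moebiusJacobian A z)).restrictScalars ℝ) := rfl
  rw [h1, LinearMap.det_restrictScalars, Algebra.norm_complex_apply,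
    Matrix.toEuclideanLin_eq_toLin_orthonormal, LinearMap.det_toLin, det_moebiusJacobian A hz,
    Complex.normSq_eq_norm_sq, abs_of_nonneg (by positivity)]
  simp [← pow_mul, mul_comm]

theorem moebius_inv_moebius {n : ℕ} (A : SU n) {z : Cn n} (hz : z ∈ ball (0 : Cn n) 1) :
    moebius A⁻¹ (moebius A z) = z := by
  rw [← (cocycle_aux A⁻¹ A hz).2, inv_mul_cancel, (one_aux hz).2]

theorem moebius_image_ball {n : ℕ} (A : SU n) :
    moebius A '' ball (0 : Cn n) 1 = ball (0 : Cn n) 1 := by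
  refine Set.Subset.antisymm (Set.image_subset_iff.2 fun z hz => moebius_mem A hz) fun z hz => ?_
  refine ⟨moebius A⁻¹ z, moebius_mem _ hz, ?_⟩
  have := moebius_inv_moebius A⁻¹ hz
  rwa [inv_inv] at this

/-! ### Change of variables for the weighted measure -/

theorem measurable_den {n : ℕ} (A : SU n) : Measurable (den A) := by
  unfold den
  fun_prop

theorem measurable_moebius {n : ℕ} (A : SU n) : Measurable (moebius A) := by
  unfold moebius
  have := measurable_den A
  refine (PiLp.continuous_toLp 2 _).measurable.comp (measurable_pi_lambda _ fun i => ?_)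
  fun_prop

/-- The weight `|j_lam(A, z)|² = |wᵗ z + d| ^ (-2 lam)`. -/
def cocycleWeight {n : ℕ} (lam : ℝ) (A : SU n) (z : Cn n) : ℝ≥0∞ :=
  ENNReal.ofReal (‖den A z‖ ^ (-2 * lam))

theorem measurable_cocycleWeight {n : ℕ} (lam : ℝ) (A : SU n) :
    Measurable (cocycleWeight lam A) := by
  have := measurable_den A
  unfold cocycleWeight
  fun_prop

theorem measurable_bergmanDensity (n : ℕ) (lam : ℝ) : Measurable fun z : Cn n =>
    ENNReal.ofReal (bergmanConst n lam * (1 - ‖z‖ ^ 2) ^ (lam - n - 1)) := by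
  fun_prop

/-- `G` may be non-measurable, because the density is measurable and finite everywhere. -/
theorem lintegral_bergmanMeasure {n : ℕ} (lam : ℝ) (G : Cn n → ℝ≥0∞) :
    ∫⁻ z, G z ∂(bergmanMeasure n lam) = (volume (ball (0 : Cn n) 1))⁻¹ *
      ∫⁻ z in ball (0 : Cn n) 1,
        ENNReal.ofReal (bergmanConst n lam * (1 - ‖z‖ ^ 2) ^ (lam - n - 1)) * G z := by
  rw [bergmanMeasure, lintegral_withDensity_eq_lintegral_mul_non_measurable _
    (measurable_bergmanDensity n lam) (Filter.Eventually.of_forall fun z => ENNReal.ofReal_lt_top),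
    ballVolume, lintegral_smul_measure]
  rfl

theorem ae_mem_ball (n : ℕ) (lam : ℝ) : ∀ᵐ z ∂(bergmanMeasure n lam), z ∈ ball (0 : Cn n) 1 := by
  refine (withDensity_absolutelyContinuous _ _).ae_le ?_
  exact Measure.ae_smul_measure (ae_restrict_mem measurableSet_ball) _

/-- Change of variables by a Möbius transformation. -/
theorem lintegral_cocycleWeight_mul {n : ℕ} (lam : ℝ) (A : SU n) (G : Cn n → ℝ≥0∞) :
    ∫⁻ z, cocycleWeight lam A z * G (moebius A z) ∂(bergmanMeasure n lam) =
      ∫⁻ z, G z ∂(bergmanMeasure n lam) := by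
  rw [lintegral_bergmanMeasure, lintegral_bergmanMeasure]
  congr 1
  have hinj : Set.InjOn (moebius A) (ball (0 : Cn n) 1) := fun z hz w hw h => by
    rw [← moebius_inv_moebius A hz, h, moebius_inv_moebius A hw]
  have hcov := lintegral_image_eq_lintegral_abs_det_fderiv_mul volume measurableSet_ball
    (fun z hz => ((hasFDerivAt_moebius A hz).restrictScalars ℝ).hasFDerivWithinAt) hinj
    (fun z => ENNReal.ofReal (bergmanConst n lam * (1 - ‖z‖ ^ 2) ^ (lam - n - 1)) * G z)
  rw [moebius_image_ball] at hcov
  rw [hcov]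
  refine setLIntegral_congr_fun measurableSet_ball fun z hz => ?_
  simp only
  rw [abs_det_fderiv_moebius A hz, cocycleWeight, ← mul_assoc, ← mul_assoc,
    ← ENNReal.ofReal_mul' (by positivity), ← ENNReal.ofReal_mul (by positivity)]
  congr 2
  have hd : 0 < ‖den A z‖ := norm_pos_iff.2 (den_ne_zero A hz)
  have hpos : 0 < 1 - ‖moebius A z‖ ^ 2 := by
    have := mem_ball_zero_iff.1 (moebius_mem A hz)
    have := norm_nonneg (moebius A z)
    nlinarith
  rw [← norm_den_sq_mul A hz, Real.mul_rpow (by positivity) hpos.le, ← Real.rpow_natCast,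
    ← Real.rpow_mul hd.le, ← Real.rpow_natCast (‖den A z‖⁻¹), Real.inv_rpow hd.le,
    ← Real.rpow_neg hd.le]
  -- Writing 1 - |z|² = |d|²(1 - |Az|²) extracts |d|^(2(lam-n-1)) from the weight. Together with
  -- |j|² = |d|^(-2lam) this is exactly the Jacobian |d|^(-2(n+1)).
  have h : ‖den A z‖ ^ (((2 : ℕ) : ℝ) * (lam - n - 1)) * ‖den A z‖ ^ (-2 * lam) =
      ‖den A z‖ ^ (-((2 * (n + 1) : ℕ) : ℝ)) := by
    rw [← Real.rpow_add hd]
    congr 1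
    push_cast
    ring
  rw [← h]
  ring

/-- The change of variables tested on indicators. As an equality of measures it passes to Bochner
integrals. -/
theorem map_moebius_withDensity {n : ℕ} (lam : ℝ) (A : SU n) :
    ((bergmanMeasure n lam).withDensity (cocycleWeight lam A)).map (moebius A) =
      bergmanMeasure n lam := by
  ext S hS
  rw [Measure.map_apply (measurable_moebius A) hS,
    withDensity_apply _ (measurable_moebius A hS), ← lintegral_indicator (measurable_moebius A hS),
    ← lintegral_indicator_one hS, ← lintegral_cocycleWeight_mul lam A (S.indicator 1)]
  refine lintegral_congr fun z => ?_
  by_cases hz : moebius A z ∈ S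
  · rw [Set.indicator_of_mem (show z ∈ moebius A ⁻¹' S from hz), Set.indicator_of_mem hz]
    simp
  · rw [Set.indicator_of_notMem (show z ∉ moebius A ⁻¹' S from hz), Set.indicator_of_notMem hz]
    simp

theorem integral_cocycleWeight_smul {n : ℕ} (lam : ℝ) (A : SU n) {G : Cn n → ℂ}
    (hG : AEStronglyMeasurable G (bergmanMeasure n lam)) :
    ∫ z, (cocycleWeight lam A z).toReal • G (moebius A z) ∂(bergmanMeasure n lam) =
      ∫ z, G z ∂(bergmanMeasure n lam) := by
  conv_rhs => rw [← map_moebius_withDensity lam A]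
  rw [integral_map (measurable_moebius A).aemeasurable (by rwa [map_moebius_withDensity]),
    integral_withDensity_eq_integral_toReal_smul (measurable_cocycleWeight lam A)
      (Filter.Eventually.of_forall fun z => ENNReal.ofReal_lt_top)]

/-! ### The invariant pseudo-distance on the ball -/

section Ptolemy

variable {V : Type*} [NormedAddCommGroup V] [InnerProductSpace ℂ V]

/-- The right side is a positive semidefinite hermitian form Q_c(b - c, a - c) when |c| ≤ 1. Thus
the error in replacing (1 - ⟨b,a⟩)(1 - |c|²) by the product on the left is accessible to the
Cauchy–Schwarz inequality. -/
theorem one_sub_inner_mul_sub (a b c : V) :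
    (1 - inner ℂ c a) * (1 - inner ℂ b c) - (1 - inner ℂ b a) * (1 - (‖c‖ : ℂ) ^ 2) =
      (1 - (‖c‖ : ℂ) ^ 2) * inner ℂ (b - c) (a - c) +
        inner ℂ c (a - c) * inner ℂ (b - c) c := by
  have h : inner ℂ c c = (‖c‖ : ℂ) ^ 2 := inner_self_eq_norm_sq_to_K c
  simp only [inner_sub_left, inner_sub_right, h]
  ring

/-- The case b = a of the identity: Q_c(a - c, a - c) falls short of |1 - ⟨c,a⟩|² by (1 - |a|²)(1 -
|c|²) ≥ 0. -/
theorem mul_norm_sub_sq_add_le {a c : V} (ha : ‖a‖ ≤ 1) (hc : ‖c‖ ≤ 1) :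
    (1 - ‖c‖ ^ 2) * ‖a - c‖ ^ 2 + ‖inner ℂ c (a - c)‖ ^ 2 ≤ ‖1 - inner ℂ c a‖ ^ 2 := by
  have h := one_sub_inner_mul_sub a a c
  have h1 : inner ℂ a c = conj (inner ℂ c a) := (inner_conj_symm a c).symm
  have h2 : inner ℂ (a - c) c = conj (inner ℂ c (a - c)) := (inner_conj_symm _ _).symm
  have h3 : (1 : ℂ) - conj (inner ℂ c a) = conj (1 - inner ℂ c a) := by simp
  have h4 : inner ℂ a a = (‖a‖ : ℂ) ^ 2 := inner_self_eq_norm_sq_to_K a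
  have h5 : inner ℂ (a - c) (a - c) = (‖a - c‖ : ℂ) ^ 2 := inner_self_eq_norm_sq_to_K _
  rw [h1, h2, h3, h4, h5, Complex.mul_conj', Complex.mul_conj'] at h
  have h6 : ‖1 - inner ℂ c a‖ ^ 2 - (1 - ‖a‖ ^ 2) * (1 - ‖c‖ ^ 2) =
      (1 - ‖c‖ ^ 2) * ‖a - c‖ ^ 2 + ‖inner ℂ c (a - c)‖ ^ 2 := by exact_mod_cast h
  have h7 : 0 ≤ (1 - ‖a‖ ^ 2) * (1 - ‖c‖ ^ 2) :=
    mul_nonneg (sub_nonneg.2 (pow_le_one₀ (norm_nonneg a) ha))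
      (sub_nonneg.2 (pow_le_one₀ (norm_nonneg c) hc))
  linarith

theorem norm_one_sub_inner_comm (a b : V) : ‖1 - inner ℂ a b‖ = ‖1 - inner ℂ b a‖ := by
  rw [← RCLike.norm_conj (1 - inner ℂ a b)]
  simp

/-- By Cauchy–Schwarz for Q_c and the diagonal bounds, the error term is at most the main product |1
- ⟨c,a⟩||1 - ⟨b,c⟩|; main term and error together give the factor 2. In terms of the invariant
distance this is cosh(s + t) ≤ 2 cosh s cosh t. -/
theorem norm_one_sub_inner_mul_le {a b c : V} (ha : ‖a‖ ≤ 1) (hb : ‖b‖ ≤ 1) (hc : ‖c‖ ≤ 1) :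
    ‖1 - inner ℂ b a‖ * (1 - ‖c‖ ^ 2) ≤ 2 * (‖1 - inner ℂ c a‖ * ‖1 - inner ℂ b c‖) := by
  have hs : 0 ≤ 1 - ‖c‖ ^ 2 := sub_nonneg.2 (pow_le_one₀ (norm_nonneg c) hc)
  have h := one_sub_inner_mul_sub a b c
  have h1 := mul_norm_sub_sq_add_le ha hc
  have h2 := mul_norm_sub_sq_add_le hb hc
  rw [norm_one_sub_inner_comm c b, ← inner_conj_symm c (b - c), RCLike.norm_conj] at h2
  have hnorm : ‖(1 - (‖c‖ : ℂ) ^ 2)‖ = 1 - ‖c‖ ^ 2 := by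
    rw [← Complex.ofReal_pow, ← Complex.ofReal_one, ← Complex.ofReal_sub, Complex.norm_real,
      Real.norm_of_nonneg hs]
  have h3 : ‖(1 - (‖c‖ : ℂ) ^ 2) * inner ℂ (b - c) (a - c) +
      inner ℂ c (a - c) * inner ℂ (b - c) c‖ ≤
        (1 - ‖c‖ ^ 2) * (‖a - c‖ * ‖b - c‖) + ‖inner ℂ c (a - c)‖ * ‖inner ℂ (b - c) c‖ := by
    refine (norm_add_le _ _).trans ?_
    rw [norm_mul, norm_mul, hnorm, mul_comm ‖a - c‖]
    gcongr
    exact norm_inner_le_norm _ _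
  have h4 : (1 - ‖c‖ ^ 2) * (‖a - c‖ * ‖b - c‖) + ‖inner ℂ c (a - c)‖ * ‖inner ℂ (b - c) c‖ ≤
      ‖1 - inner ℂ c a‖ * ‖1 - inner ℂ b c‖ := by
    refine abs_le_of_sq_le_sq' ?_ (by positivity) |>.2
    rw [mul_pow]
    refine le_trans ?_ (mul_le_mul h1 h2 (by positivity) (by positivity))
    -- Cauchy–Schwarz in Lagrange form: (σx² + p²)(σy² + q²) - (σxy + pq)² = σ(xq - yp)².
    nlinarith [mul_nonneg hs (sq_nonneg (‖a - c‖ * ‖inner ℂ (b - c) c‖ -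
      ‖b - c‖ * ‖inner ℂ c (a - c)‖))]
  have h5 : ‖(1 - inner ℂ b a) * (1 - (‖c‖ : ℂ) ^ 2)‖ ≤
      ‖(1 - inner ℂ c a) * (1 - inner ℂ b c)‖ + ‖1 - inner ℂ c a‖ * ‖1 - inner ℂ b c‖ := by
    have : (1 - inner ℂ b a) * (1 - (‖c‖ : ℂ) ^ 2) = (1 - inner ℂ c a) * (1 - inner ℂ b c) -
        ((1 - (‖c‖ : ℂ) ^ 2) * inner ℂ (b - c) (a - c) +
          inner ℂ c (a - c) * inner ℂ (b - c) c) := by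
      rw [← h]; ring
    rw [this]
    refine (norm_sub_le _ _).trans ?_
    gcongr
    exact h3.trans h4
  rw [norm_mul, norm_mul, hnorm] at h5
  linarith

end Ptolemy

/-- The quantity `(1 - |z|²) (1 - |w|²) / |1 - ⟨z, w⟩|²`, which is `1 / cosh²` of the invariant
distance of the points `z` and `w` of the ball. -/
def nearness {n : ℕ} (z w : Cn n) : ℝ :=
  (1 - ‖z‖ ^ 2) * (1 - ‖w‖ ^ 2) / ‖1 - inner ℂ w z‖ ^ 2

theorem nearness_comm {n : ℕ} (z w : Cn n) : nearness z w = nearness w z := by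
  rw [nearness, nearness, norm_one_sub_inner_comm, mul_comm (1 - ‖z‖ ^ 2)]

theorem one_sub_norm_sq_pos {n : ℕ} {z : Cn n} (hz : z ∈ ball (0 : Cn n) 1) :
    0 < 1 - ‖z‖ ^ 2 := by
  have := mem_ball_zero_iff.1 hz
  have := norm_nonneg z
  nlinarith

theorem norm_one_sub_inner_ge {n : ℕ} {z w : Cn n} (hw : w ∈ ball (0 : Cn n) 1) :
    1 - ‖z‖ ≤ ‖1 - inner ℂ w z‖ := by
  have h1 := norm_sub_norm_le (1 : ℂ) (inner ℂ w z)
  have h2 := norm_inner_le_norm (𝕜 := ℂ) w z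
  have h3 : ‖w‖ * ‖z‖ ≤ 1 * ‖z‖ := by
    gcongr
    exact (mem_ball_zero_iff.1 hw).le
  rw [norm_one] at h1
  linarith

theorem norm_one_sub_inner_pos {n : ℕ} {z w : Cn n} (hz : z ∈ ball (0 : Cn n) 1)
    (hw : w ∈ ball (0 : Cn n) 1) : 0 < ‖1 - inner ℂ w z‖ :=
  lt_of_lt_of_le (sub_pos.2 (mem_ball_zero_iff.1 hz)) (norm_one_sub_inner_ge hw)

/-- The matrix preserves the sesquilinear form of `J`, whose value on the vectors (w, 1) and (z, 1)
is 1 - ⟨w, z⟩; each vector is mapped to its denominator times the vector of the image point. -/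
theorem inner_moebius {n : ℕ} (A : SU n) {z w : Cn n} (hz : z ∈ ball (0 : Cn n) 1)
    (hw : w ∈ ball (0 : Cn n) 1) :
    conj (den A w) * den A z * (1 - inner ℂ (moebius A w) (moebius A z)) = 1 - inner ℂ w z := by
  have hform : ∀ z w : Cn n, star (hvec w) ⬝ᵥ (J n *ᵥ hvec z) = 1 - inner ℂ w z := by
    intro z w
    have hJ : J n = Matrix.diagonal (Sum.elim (fun _ => -1) (fun _ => 1)) := by
      rw [J, ← Matrix.fromBlocks_diagonal]
      congr 1
      · ext i j; by_cases h : i = j <;> simp [h, Matrix.diagonal]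
    rw [hJ]
    simp only [dotProduct, Matrix.mulVec_diagonal, Fintype.sum_sum_type]
    simp [hvec, PiLp.inner_apply, mul_comm]
    ring
  have h : star (mat A *ᵥ hvec w) ⬝ᵥ (J n *ᵥ (mat A *ᵥ hvec z)) =
      star (hvec w) ⬝ᵥ (J n *ᵥ hvec z) := by
    rw [Matrix.star_mulVec, ← Matrix.dotProduct_mulVec, Matrix.mulVec_mulVec,
      Matrix.mulVec_mulVec, conjTranspose_mul_mat A]
  rw [mulVec_hvec A hz, mulVec_hvec A hw, Matrix.mulVec_smul, star_smul, smul_dotProduct,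
    dotProduct_smul, hform, hform] at h
  rw [← h]
  simp [mul_assoc]

/-- The nearness of two points is invariant under Möbius transformations. -/
theorem nearness_moebius {n : ℕ} (A : SU n) {z w : Cn n} (hz : z ∈ ball (0 : Cn n) 1)
    (hw : w ∈ ball (0 : Cn n) 1) : nearness (moebius A z) (moebius A w) = nearness z w := by
  have hdz := norm_pos_iff.2 (den_ne_zero A hz)
  have hdw := norm_pos_iff.2 (den_ne_zero A hw)
  have hp := norm_one_sub_inner_pos (moebius_mem A hz) (moebius_mem A hw)
  rw [nearness, nearness, ← inner_moebius A hz hw, ← norm_den_sq_mul A hz,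
    ← norm_den_sq_mul A hw, norm_mul, norm_mul, RCLike.norm_conj]
  field_simp

/-- The quasi-triangle inequality: two points that are both near c are near each other. It is the
square of `norm_one_sub_inner_mul_le`, whence the constant 4. -/
theorem nearness_mul_nearness_le {n : ℕ} {a b c : Cn n} (ha : a ∈ ball (0 : Cn n) 1)
    (hb : b ∈ ball (0 : Cn n) 1) (hc : c ∈ ball (0 : Cn n) 1) :
    nearness a c * nearness c b ≤ 4 * nearness a b := by
  have hab := norm_one_sub_inner_pos ha hb
  have hac := norm_one_sub_inner_pos ha hc
  have hcb := norm_one_sub_inner_pos hc hb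
  have ha1 := one_sub_norm_sq_pos ha
  have hb1 := one_sub_norm_sq_pos hb
  have hc1 := one_sub_norm_sq_pos hc
  have h := norm_one_sub_inner_mul_le (mem_ball_zero_iff.1 ha).le (mem_ball_zero_iff.1 hb).le
    (mem_ball_zero_iff.1 hc).le
  have h2 := pow_le_pow_left₀ (by positivity) h 2
  rw [nearness, nearness, nearness, div_mul_div_comm, mul_div_assoc', div_le_div_iff₀
    (by positivity) (by positivity)]
  have h3 := mul_le_mul_of_nonneg_left h2 (mul_nonneg ha1.le hb1.le)
  calc _ = (1 - ‖a‖ ^ 2) * (1 - ‖b‖ ^ 2) * (‖1 - inner ℂ b a‖ * (1 - ‖c‖ ^ 2)) ^ 2 := by ring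
    _ ≤ _ := h3
    _ = _ := by ring

/-- On a compact ball the nearness is bounded below, so a small Euclidean ball lies in an invariant
neighbourhood of its centre. -/
theorem le_nearness {n : ℕ} {z w : Cn n} {s : ℝ} (hs : s < 1) (hz : ‖z‖ ≤ s) (hw : ‖w‖ ≤ s) :
    (1 - s ^ 2) ^ 2 / 4 ≤ nearness z w := by
  have hs0 : 0 ≤ s := (norm_nonneg z).trans hz
  have hzb : z ∈ ball (0 : Cn n) 1 := mem_ball_zero_iff.2 (hz.trans_lt hs)
  have hwb : w ∈ ball (0 : Cn n) 1 := mem_ball_zero_iff.2 (hw.trans_lt hs)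
  have hp := norm_one_sub_inner_pos hzb hwb
  have h1 : ‖1 - inner ℂ w z‖ ≤ 2 := by
    refine (norm_sub_le _ _).trans ?_
    have h2 := norm_inner_le_norm (𝕜 := ℂ) w z
    have h3 : ‖w‖ * ‖z‖ ≤ 1 * 1 :=
      mul_le_mul (hw.trans hs.le) (hz.trans hs.le) (norm_nonneg _) zero_le_one
    rw [norm_one]
    linarith
  have hs2 : 0 ≤ 1 - s ^ 2 := by nlinarith
  have h4 : 1 - s ^ 2 ≤ 1 - ‖z‖ ^ 2 := by gcongr
  have h5 : 1 - s ^ 2 ≤ 1 - ‖w‖ ^ 2 := by gcongr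
  rw [nearness, sq (1 - s ^ 2)]
  refine div_le_div₀ (mul_nonneg (hs2.trans h4) (hs2.trans h5))
    (mul_le_mul h4 h5 hs2 (hs2.trans h4)) (by positivity) ?_
  nlinarith

/-- Points near a fixed z stay away from the unit sphere. -/
theorem nearness_mul_le {n : ℕ} {z w : Cn n} (hz : z ∈ ball (0 : Cn n) 1)
    (hw : w ∈ ball (0 : Cn n) 1) : nearness z w * (1 - ‖z‖) ^ 2 ≤ 1 - ‖w‖ ^ 2 := by
  have hp := norm_one_sub_inner_pos hz hw
  have h0 : 0 ≤ 1 - ‖z‖ := sub_nonneg.2 (mem_ball_zero_iff.1 hz).le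
  have h1 := pow_le_pow_left₀ h0 (norm_one_sub_inner_ge (z := z) hw) 2
  have hw1 := one_sub_norm_sq_pos hw
  have hz1 := one_sub_norm_sq_pos hz
  rw [nearness, div_mul_eq_mul_div, div_le_iff₀ (by positivity)]
  have h2 : (1 - ‖z‖ ^ 2) * (1 - ‖w‖ ^ 2) ≤ 1 * (1 - ‖w‖ ^ 2) := by
    gcongr
    have := sq_nonneg ‖z‖
    linarith
  calc (1 - ‖z‖ ^ 2) * (1 - ‖w‖ ^ 2) * (1 - ‖z‖) ^ 2
      ≤ 1 * (1 - ‖w‖ ^ 2) * ‖1 - inner ℂ w z‖ ^ 2 := by gcongr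
    _ = _ := by ring

theorem measurable_nearness {α : Type*} [MeasurableSpace α] {n : ℕ} {f g : α → Cn n}
    (hf : Measurable f) (hg : Measurable g) :
    Measurable fun x => nearness (f x) (g x) := by
  unfold nearness
  fun_prop

/-! ### The unitary action on the Bergman space -/

theorem aestronglyMeasurable_of_differentiableOn {n : ℕ} (lam : ℝ) {F : Cn n → ℂ}
    (hF : DifferentiableOn ℂ F (ball 0 1)) : AEStronglyMeasurable F (bergmanMeasure n lam) := by
  have h : bergmanMeasure n lam ≪ (volume : Measure (Cn n)).restrict (ball 0 1) :=
    (withDensity_absolutelyContinuous _ _).trans Measure.smul_absolutelyContinuous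
  exact (hF.continuousOn.aestronglyMeasurable measurableSet_ball).mono_ac h

section Translation

variable {n : ℕ} {lam : ℝ}

theorem autj_mul (g h : Cover n) (z : Ball n) :
    autj lam (g * h) z = autj lam g (h • z) * autj lam h z := by
  rw [autj, autj, autj, ← Complex.exp_add, Cover.logDen_mul, Cover.smul_def]
  congr 1
  ring

theorem autj_one (z : Ball n) : autj lam (1 : Cover n) z = 1 := by
  simp [autj, Cover.logDen_one]

theorem autj_ne_zero (g : Cover n) (z : Ball n) : autj lam g z ≠ 0 := Complex.exp_ne_zero _

theorem autj_inv_smul (g : Cover n) (z : Ball n) :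
    autj lam g⁻¹ (g • z) = (autj lam g z)⁻¹ := by
  refine eq_inv_of_mul_eq_one_left ?_
  rw [← autj_mul, inv_mul_cancel, autj_one]

theorem norm_autj (g : Cover n) (z : Ball n) :
    ‖autj lam g z‖ = ‖den g.base z‖ ^ (-lam) := by
  rw [autj, Complex.norm_exp, ← g.exp_logDen, Complex.norm_exp, ← Real.exp_mul]
  congr 1
  simp [mul_comm]

theorem norm_autj_sq (g : Cover n) (z : Ball n) :
    ‖autj lam g z‖ ^ 2 = ‖den g.base z‖ ^ (-2 * lam) := by
  rw [norm_autj, ← Real.rpow_natCast, ← Real.rpow_mul (norm_nonneg _)]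
  congr 1
  push_cast
  ring

variable (lam) in
/-- The factor of automorphy as a function on `ℂⁿ`, holomorphic on the unit ball. -/
def autjExt (g : Cover n) (z : Cn n) : ℂ :=
  Complex.exp (-(lam : ℂ) * (g.logDen (ballZero n) +
    Complex.log (1 + (den g.base z - den g.base 0) / den g.base 0)))

theorem autjExt_coe (g : Cover n) (z : Ball n) : autjExt lam g z = autj lam g z := by
  rw [autj, autjExt, Cover.logDen_eq z]

theorem differentiable_den (A : SU n) : Differentiable ℂ (den A) :=
  fun z => (hasFDerivAt_den A z).differentiableAt

theorem differentiableOn_autjExt (g : Cover n) :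
    DifferentiableOn ℂ (autjExt lam g) (ball 0 1) := by
  have := differentiable_den g.base
  refine ((DifferentiableOn.clog ?_ fun z hz =>
    one_add_mem_slitPlane g.base ⟨z, hz⟩).const_add _).const_mul _ |>.cexp
  exact Differentiable.differentiableOn (by fun_prop)

theorem differentiableOn_moebius (A : SU n) : DifferentiableOn ℂ (moebius A) (ball 0 1) :=
  fun _ hz => (hasFDerivAt_moebius A hz).differentiableAt.differentiableWithinAt

theorem enorm_autjExt_sq (g : Cover n) {z : Cn n} (hz : z ∈ ball (0 : Cn n) 1) :
    ‖autjExt lam g z‖ₑ ^ 2 = cocycleWeight lam g.base z := by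
  rw [cocycleWeight, ← norm_autj_sq g ⟨z, hz⟩, ← autjExt_coe, ENNReal.ofReal_pow (norm_nonneg _),
    ofReal_norm]

theorem toReal_cocycleWeight (g : Cover n) {z : Cn n} (hz : z ∈ ball (0 : Cn n) 1) :
    (cocycleWeight lam g.base z).toReal = ‖autjExt lam g z‖ ^ 2 := by
  rw [← enorm_autjExt_sq g hz, ENNReal.toReal_pow, toReal_enorm]

theorem differentiableOn_autjExt_mul (g : Cover n) {F : Cn n → ℂ}
    (hF : DifferentiableOn ℂ F (ball 0 1)) :
    DifferentiableOn ℂ (fun z => autjExt lam g z * F (moebius g.base z)) (ball 0 1) :=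
  (differentiableOn_autjExt g).mul
    (hF.comp (differentiableOn_moebius g.base) fun _ hz => moebius_mem g.base hz)

/-- With G = 1 this says that the group action preserves the norm. With G the indicator of an
invariant neighbourhood it transports local estimates from one point to another. -/
theorem lintegral_autjExt_mul (g : Cover n) (F : Cn n → ℂ) (G : Cn n → ℝ≥0∞) :
    ∫⁻ z, ‖autjExt lam g z * F (moebius g.base z)‖ₑ ^ 2 * G (moebius g.base z)
      ∂(bergmanMeasure n lam) = ∫⁻ z, ‖F z‖ₑ ^ 2 * G z ∂(bergmanMeasure n lam) := by
  rw [← lintegral_cocycleWeight_mul lam g.base fun z => ‖F z‖ₑ ^ 2 * G z]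
  refine lintegral_congr_ae ?_
  filter_upwards [ae_mem_ball n lam] with z hz
  rw [enorm_mul, mul_pow, enorm_autjExt_sq g hz, mul_assoc]

theorem eLpNorm_two_sq {α : Type*} [MeasurableSpace α] (m : Measure α) (F : α → ℂ) :
    eLpNorm F 2 m ^ 2 = ∫⁻ z, ‖F z‖ₑ ^ 2 ∂m := by
  rw [eLpNorm_eq_lintegral_rpow_enorm_toReal (by norm_num) (by norm_num), ← ENNReal.rpow_natCast,
    ← ENNReal.rpow_mul]
  norm_num

theorem memLp_autjExt_mul (g : Cover n) (f : Bergman n lam) :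
    MemLp (fun z => autjExt lam g z * hol f (moebius g.base z)) 2 (bergmanMeasure n lam) := by
  refine ⟨aestronglyMeasurable_of_differentiableOn lam
    (differentiableOn_autjExt_mul g (hol_differentiableOn f)), ?_⟩
  refine (ENNReal.pow_lt_top_iff.1 ?_).resolve_right two_ne_zero
  rw [eLpNorm_two_sq]
  have h := lintegral_autjExt_mul (lam := lam) g (hol f) fun _ => 1
  simp only [mul_one] at h
  rw [h, ← eLpNorm_two_sq, eLpNorm_hol]
  simp

theorem bergman_ext {f g : Bergman n lam} (h : ∀ z ∈ ball (0 : Cn n) 1, hol f z = hol g z) :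
    f = g := by
  refine Subtype.ext (Lp.ext ?_)
  filter_upwards [coe_ae_eq_hol f, coe_ae_eq_hol g, ae_mem_ball n lam] with z h1 h2 h3
  rw [h1, h2, h z h3]

/-- The action `f ↦ j_lam(g, ·) f(g ·)` of the covering group on the Bergman space. -/
def translate (g : Cover n) (f : Bergman n lam) : Bergman n lam :=
  ⟨(memLp_autjExt_mul g f).toLp, _, differentiableOn_autjExt_mul g (hol_differentiableOn f),
    (memLp_autjExt_mul g f).coeFn_toLp⟩

theorem inner_coe_smul_eq_integral (φ : Lp ℂ ∞ (bergmanMeasure n lam)) (a b : Bergman n lam) :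
    inner ℂ (a : L2 n lam) (φ • (b : L2 n lam) : L2 n lam) =
      ∫ z, φ z * hol b z * conj (hol a z) ∂(bergmanMeasure n lam) := by
  rw [L2.inner_def]
  refine integral_congr_ae ?_
  filter_upwards [coe_ae_eq_hol a, coe_ae_eq_hol b,
    Lp.coeFn_lpSMul (r := 2) φ (b : L2 n lam)] with z h1 h2 h3
  rw [h3, h1, Pi.smul_apply', h2]
  simp

/-- The factor 1 stands in the place of the symbol, so that `integral_mul_translate` applies with
the constant function. -/
theorem inner_eq_integral (a b : Bergman n lam) :
    inner ℂ a b = ∫ z, 1 * hol b z * conj (hol a z) ∂(bergmanMeasure n lam) := by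
  rw [Submodule.coe_inner, L2.inner_def]
  refine integral_congr_ae ?_
  filter_upwards [coe_ae_eq_hol a, coe_ae_eq_hol b] with z h1 h2
  rw [h1, h2]
  simp

variable [Fact ((n : ℝ) < lam)]

/-- `hol` is a choice of representative; its values on the ball are determined because almost
everywhere equal holomorphic functions agree there. -/
theorem hol_eq_of_ae_eq {f : Bergman n lam} {F : Cn n → ℂ} (hF : DifferentiableOn ℂ F (ball 0 1))
    (h : (f : L2 n lam) =ᵐ[bergmanMeasure n lam] F) {z : Cn n} (hz : z ∈ ball (0 : Cn n) 1) :
    hol f z = F z :=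
  eq_of_ae_eq (hol_differentiableOn f) hF ((coe_ae_eq_hol f).symm.trans h) hz

theorem hol_translate (g : Cover n) (f : Bergman n lam) (z : Ball n) :
    hol (translate g f) z = autj lam g z * hol f (g • z : Ball n) := by
  rw [hol_eq_of_ae_eq (f := translate g f) (differentiableOn_autjExt_mul g (hol_differentiableOn f))
    (memLp_autjExt_mul g f).coeFn_toLp z.2, autjExt_coe, Cover.smul_def, coe_smul]

theorem translate_translate_inv (g : Cover n) (f : Bergman n lam) :
    translate g (translate g⁻¹ f) = f := by
  refine bergman_ext fun z hz => ?_
  have h1 := hol_translate g (translate g⁻¹ f) ⟨z, hz⟩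
  rw [hol_translate g⁻¹ f (g • ⟨z, hz⟩), autj_inv_smul, inv_smul_smul,
    mul_inv_cancel_left₀ (autj_ne_zero g _)] at h1
  exact h1

/-- The two translates contribute j and its conjugate, hence |j|², which is the weight in the change
of variables. The function 1 gives unitarity of the action, and an invariant symbol gives its
covariance. -/
theorem integral_mul_translate {ψ : Cn n → ℂ}
    (hψ : AEStronglyMeasurable ψ (bergmanMeasure n lam)) (g : Cover n)
    (hinv : ∀ᵐ z ∂(bergmanMeasure n lam), ψ (moebius g.base z) = ψ z) (a b : Bergman n lam) :
    ∫ z, ψ z * hol (translate g b) z * conj (hol (translate g a) z) ∂(bergmanMeasure n lam) =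
      ∫ z, ψ z * hol b z * conj (hol a z) ∂(bergmanMeasure n lam) := by
  have ha := aestronglyMeasurable_of_differentiableOn lam (hol_differentiableOn a)
  have hb := aestronglyMeasurable_of_differentiableOn lam (hol_differentiableOn b)
  refine Eq.trans ?_ (integral_cocycleWeight_smul lam g.base ((hψ.mul hb).mul
    (Complex.continuous_conj.comp_aestronglyMeasurable ha)))
  refine integral_congr_ae ?_
  filter_upwards [hinv, ae_mem_ball n lam] with z h1 hz
  have h2 := hol_translate g a ⟨z, hz⟩
  have h3 := hol_translate g b ⟨z, hz⟩
  rw [← autjExt_coe, Cover.smul_def, coe_smul] at h2 h3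
  simp only at h2 h3
  rw [h2, h3, toReal_cocycleWeight g hz, Complex.real_smul]
  simp only [map_mul, h1]
  rw [Complex.ofReal_pow, ← Complex.mul_conj']
  ring

theorem inner_translate (g : Cover n) (a b : Bergman n lam) :
    inner ℂ (translate g a) (translate g b) = inner ℂ a b := by
  rw [inner_eq_integral, inner_eq_integral]
  exact integral_mul_translate aestronglyMeasurable_const g (Filter.Eventually.of_forall fun _ => rfl)
    a b

/-- By unitarity, pairing the translate of K_{g·w} with f pairs K_{g·w} with the translate of f by
g⁻¹, which gives j(g⁻¹, g·w) f(w) = j(g,w)⁻¹ f(w). The conjugate appears because the scalar stands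
in the conjugate linear variable. -/
theorem translate_kernelAt (g : Cover n) (w : Ball n) :
    translate g (kernelAt n lam (g • w)) = (conj (autj lam g w))⁻¹ • kernelAt n lam w := by
  refine ext_inner_right ℂ fun f => ?_
  conv_lhs => rw [← translate_translate_inv g f]
  rw [inner_translate, inner_kernelAt, hol_translate, autj_inv_smul, inv_smul_smul]
  rw [Submodule.coe_inner, Submodule.coe_smul]
  have h := inner_smul_left (𝕜 := ℂ) (kernelAt n lam w : L2 n lam) (f : L2 n lam)
    (conj (autj lam g w))⁻¹
  rw [← Submodule.coe_inner, inner_kernelAt] at h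
  refine Eq.trans ?_ h.symm
  simp

/-- Covariance of the sesquilinear form of an invariant multiplication operator at the
reproducing kernel elements. -/
theorem inner_kernelAt_smul {φ : Lp ℂ ∞ (bergmanMeasure n lam)} (g : Cover n)
    (hφ : ∀ᵐ z ∂(bergmanMeasure n lam), φ (moebius g.base z) = φ z) (u w : Ball n) :
    inner ℂ (kernelAt n lam u : L2 n lam) (φ • (kernelAt n lam w : L2 n lam) : L2 n lam) =
      autj lam g u * conj (autj lam g w) * inner ℂ (kernelAt n lam (g • u) : L2 n lam)
        (φ • (kernelAt n lam (g • w) : L2 n lam) : L2 n lam) := by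
  -- Translating K_{g·u} and K_{g·w} produces K_u and K_w up to inverse factors of automorphy, which
  -- the prefactor cancels.
  have h := integral_mul_translate (Lp.aestronglyMeasurable φ) g hφ
    (kernelAt n lam (g • u)) (kernelAt n lam (g • w))
  rw [inner_coe_smul_eq_integral, inner_coe_smul_eq_integral, ← h, translate_kernelAt,
    translate_kernelAt, ← integral_const_mul]
  refine integral_congr_ae ?_
  filter_upwards [ae_mem_ball n lam] with z hz
  rw [hol_smul _ _ hz, hol_smul _ _ hz]
  have h1 := autj_ne_zero (lam := lam) g u
  have h2 := (map_ne_zero (starRingEnd ℂ)).2 (autj_ne_zero (lam := lam) g w)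
  simp only [map_mul, map_inv₀, Complex.conj_conj]
  field_simp

end Translation

/-! ### Boundedness of the restriction operator -/

section Restriction

/-- The pairs of points of the ball whose nearness is at least `c`. -/
def nearSet (n : ℕ) (c : ℝ) : Set (Cn n × Cn n) := {p | c ≤ nearness p.1 p.2}

theorem measurableSet_nearSet (n : ℕ) (c : ℝ) : MeasurableSet (nearSet n c) :=
  measurableSet_le measurable_const (measurable_nearness measurable_fst measurable_snd)

theorem measurable_indicator_nearSet {α : Type*} [MeasurableSpace α] {n : ℕ} (c : ℝ)
    {f g : α → Cn n} (hf : Measurable f) (hg : Measurable g) :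
    Measurable fun x => (nearSet n c).indicator (1 : Cn n × Cn n → ℝ≥0∞) (f x, g x) :=
  Measurable.comp (g := (nearSet n c).indicator (1 : Cn n × Cn n → ℝ≥0∞))
    (measurable_one.indicator (measurableSet_nearSet n c)) (hf.prodMk hg)

variable {n : ℕ} {lam : ℝ}

/-- A mean value inequality for the squares of holomorphic functions, on an invariant
neighbourhood. -/
theorem exists_enorm_sq_le [Fact ((n : ℝ) < lam)] (z₀ : Ball n) :
    ∃ c : ℝ, 0 < c ∧ ∃ C : ℝ≥0∞, C ≠ ∞ ∧ ∀ F : Cn n → ℂ, DifferentiableOn ℂ F (ball 0 1) →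
      ‖F z₀‖ₑ ^ 2 ≤ C * ∫⁻ z, ‖F z‖ₑ ^ 2 * (nearSet n c).indicator 1 (z, (z₀ : Cn n))
        ∂(bergmanMeasure n lam) := by
  have hz : ‖(z₀ : Cn n)‖ < 1 := mem_ball_zero_iff.1 z₀.2
  -- The ball of radius ρ about z₀ lies in the ball of radius s < 1 about 0. There Lebesgue measure
  -- is dominated by the weighted measure, and `le_nearness` supplies the constant (1 - s²)²/4.
  set ρ : ℝ := (1 - ‖(z₀ : Cn n)‖) / 2 with hρ
  set s : ℝ := (1 + ‖(z₀ : Cn n)‖) / 2 with hs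
  have hz0 := norm_nonneg (z₀ : Cn n)
  have hρ0 : 0 < ρ := by rw [hρ]; linarith
  have hs0 : 0 ≤ s := by rw [hs]; linarith
  have hs1 : s < 1 := by rw [hs]; linarith
  obtain ⟨D, hD, hle⟩ := volume_restrict_le n lam hs0 hs1
  set W : ℝ≥0∞ := volume (ball (0 : Cn n) ρ) with hW
  have hW0 : W ≠ 0 := (measure_ball_pos volume _ hρ0).ne'
  have hWt : W ≠ ∞ := measure_ball_lt_top.ne
  have hsub : ball (z₀ : Cn n) ρ ⊆ ball (0 : Cn n) s := by
    refine ball_subset_ball' ?_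
    rw [dist_zero_right, hρ, hs]
    linarith
  refine ⟨(1 - s ^ 2) ^ 2 / 4, ?_, W⁻¹ * D, ENNReal.mul_ne_top (ENNReal.inv_ne_top.2 hW0) hD, ?_⟩
  · have : 0 < 1 - s ^ 2 := by nlinarith
    positivity
  intro F hF
  -- Applied to the holomorphic function F², the mean value inequality is already an L² estimate.
  have h1 := enorm_mul_volume_le (F := fun z => F z ^ 2) (w := (z₀ : Cn n)) (ρ := ρ)
    ((hF.pow 2).mono (hsub.trans (ball_subset_ball hs1.le)))
  have h2 : ∫⁻ z in ball (z₀ : Cn n) ρ, ‖F z ^ 2‖ₑ ≤ D * ∫⁻ z, ‖F z‖ₑ ^ 2 *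
      (nearSet n ((1 - s ^ 2) ^ 2 / 4)).indicator 1 (z, (z₀ : Cn n)) ∂(bergmanMeasure n lam) := by
    rw [← smul_eq_mul, ← lintegral_smul_measure]
    refine le_trans ?_ (lintegral_mono' hle le_rfl)
    rw [← lintegral_indicator measurableSet_ball, ← lintegral_indicator measurableSet_ball]
    refine lintegral_mono fun z => ?_
    by_cases hzb : z ∈ ball (z₀ : Cn n) ρ
    · have hmem : (z, (z₀ : Cn n)) ∈ nearSet n ((1 - s ^ 2) ^ 2 / 4) :=
        le_nearness hs1 (mem_ball_zero_iff.1 (hsub hzb)).le (by rw [hs]; linarith)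
      rw [Set.indicator_of_mem hzb, Set.indicator_of_mem (hsub hzb), Set.indicator_of_mem hmem]
      simp
    · rw [Set.indicator_of_notMem hzb]
      exact zero_le
  calc ‖F z₀‖ₑ ^ 2 = W⁻¹ * (‖F z₀ ^ 2‖ₑ * W) := by
        rw [mul_comm, mul_assoc, ENNReal.mul_inv_cancel hW0 hWt, mul_one, enorm_pow]
    _ ≤ _ := by
        rw [mul_assoc]
        exact mul_le_mul_right (h1.trans h2) _

/-! ### The orbit measure of invariant neighbourhoods -/

variable {H : ClosedSubgroup (SU n)} {z₀ : Ball n} {μ : Measure (Orb H z₀)}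

theorem coe_liftPt_smul (m : Orb H z₀) : ((liftPt H z₀ m • z₀ : Ball n) : Cn n) = m :=
  congrArg (fun m : Orb H z₀ => ((m : Ball n) : Cn n)) (orbMap_liftPt H z₀ m)

theorem measurable_coe_orb : Measurable fun m : Orb H z₀ => ((m : Ball n) : Cn n) :=
  measurable_subtype_coe.comp measurable_subtype_coe

theorem measurableSet_nearness_ge (c : ℝ) (z : Cn n) :
    MeasurableSet {m : Orb H z₀ | c ≤ nearness z ((m : Ball n) : Cn n)} := 
  measurableSet_le measurable_const (measurable_nearness measurable_const measurable_coe_orb)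

/-- Here |d|⁻² = (1 - |g·z|²)/(1 - |z|²) ≥ 1 - |g·z|² ≥ ε, and |j|² is the power `lam` of |d|⁻². -/
theorem rpow_le_norm_autj_sq (hlam : 0 ≤ lam) (g : Cover n) (z : Ball n) {ε : ℝ} (hε : 0 < ε)
    (h : ε ≤ 1 - ‖((g • z : Ball n) : Cn n)‖ ^ 2) : ε ^ lam ≤ ‖autj lam g z‖ ^ 2 := by
  have hd := norm_pos_iff.2 (den_ne_zero g.base z.2)
  have h1 : ‖den g.base z‖ ^ 2 * (1 - ‖((g • z : Ball n) : Cn n)‖ ^ 2) = 1 - ‖(z : Cn n)‖ ^ 2 :=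
    norm_den_sq_mul g.base z.2
  have h2 : ‖den g.base z‖ ^ 2 * ε ≤ 1 := by
    have h3 : ‖den g.base z‖ ^ 2 * ε ≤ _ := mul_le_mul_of_nonneg_left h (by positivity)
    rw [h1] at h3
    have := sq_nonneg ‖(z : Cn n)‖
    linarith
  have h4 : ε ≤ ‖den g.base z‖ ^ (-2 : ℝ) := by
    rw [Real.rpow_neg hd.le, ← one_div, le_div_iff₀ (by positivity), mul_comm]
    exact_mod_cast h2
  rw [norm_autj_sq, Real.rpow_mul hd.le]
  exact Real.rpow_le_rpow hε.le h4 hlam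

/-- Markov's inequality for |j(h,z₀)|², which is integrable over the orbit and at least ε^lam on
this set. -/
theorem measure_le_one_sub_norm_sq_lt_top
    (hD : (fun h : Htilde H => autj lam (h : Cover n) z₀) ∈ sections lam μ)
    (hlam : 0 ≤ lam) {ε : ℝ} (hε : 0 < ε) :
    μ {m | ε ≤ 1 - ‖((m : Ball n) : Cn n)‖ ^ 2} < ∞ := by
  refine lt_of_le_of_lt (measure_mono fun m hm => ?_)
    (hD.2.2.measure_ge_lt_top (Real.rpow_pos_of_pos hε lam))
  refine rpow_le_norm_autj_sq hlam _ _ hε ?_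
  have h := coe_liftPt_smul m
  change ε ≤ 1 - ‖((liftPt H z₀ m • z₀ : Ball n) : Cn n)‖ ^ 2
  rw [h]
  exact hm

/-- The sets 1 - |m|² ≥ 1/(k+1) have finite measure and exhaust the orbit. Sigma-finiteness is
needed for Tonelli's theorem. -/
theorem sigmaFinite_of_mem_sections
    (hD : (fun h : Htilde H => autj lam (h : Cover n) z₀) ∈ sections lam μ)
    (hlam : 0 ≤ lam) : SigmaFinite μ := by
  refine ⟨⟨⟨fun k => {m | 1 / ((k : ℝ) + 1) ≤ 1 - ‖((m : Ball n) : Cn n)‖ ^ 2},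
    fun _ => trivial, fun k => measure_le_one_sub_norm_sq_lt_top hD hlam (by positivity), ?_⟩⟩⟩
  refine Set.eq_univ_of_forall fun m => Set.mem_iUnion.2 ?_
  obtain ⟨k, hk⟩ := exists_nat_one_div_lt (one_sub_norm_sq_pos (m : Ball n).2)
  exact ⟨k, hk.le⟩

theorem measure_nearness_ge_lt_top
    (hD : (fun h : Htilde H => autj lam (h : Cover n) z₀) ∈ sections lam μ)
    (hlam : 0 ≤ lam) {c : ℝ} (hc : 0 < c) :
    μ {m | c ≤ nearness (z₀ : Cn n) ((m : Ball n) : Cn n)} < ∞ := by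
  have hz : 0 < 1 - ‖(z₀ : Cn n)‖ := sub_pos.2 (mem_ball_zero_iff.1 z₀.2)
  refine lt_of_le_of_lt (measure_mono fun m hm => ?_)
    (measure_le_one_sub_norm_sq_lt_top hD hlam (ε := c * (1 - ‖(z₀ : Cn n)‖) ^ 2) (by positivity))
  refine le_trans ?_ (nearness_mul_le z₀.2 (m : Ball n).2)
  exact mul_le_mul_of_nonneg_right hm (by positivity)

/-- The bound is uniform in z. Orbit points near z are near one of them, A·z₀, by the quasi-triangle
inequality, and A⁻¹ carries them into one fixed neighbourhood of z₀ without changing their measure.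
-/
theorem measure_nearness_ge_le [SMulInvariantMeasure H.toSubgroup (Orb H z₀) μ] {c : ℝ}
    (hc : 0 ≤ c) {z : Cn n} (hz : z ∈ ball (0 : Cn n) 1) :
    μ {m | c ≤ nearness z ((m : Ball n) : Cn n)} ≤
      μ {m | c ^ 2 / 4 ≤ nearness (z₀ : Cn n) ((m : Ball n) : Cn n)} := by
  -- The point z need not lie on the orbit, so the comparison needs an orbit point near z; without
  -- one the set is empty.
  by_cases hne : ∃ m₀ : Orb H z₀, c ≤ nearness z ((m₀ : Ball n) : Cn n)
  swap
  · push Not at hne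
    have : {m : Orb H z₀ | c ≤ nearness z ((m : Ball n) : Cn n)} = ∅ :=
      Set.eq_empty_of_forall_notMem fun m hm => absurd hm (not_le.2 (hne m))
    rw [this]
    simp
  obtain ⟨m₀, hA⟩ := hne
  obtain ⟨A, hAm⟩ := m₀.2
  have hmeas := measurableSet_nearness_ge (H := H) (z₀ := z₀) (c ^ 2 / 4) (z₀ : Cn n)
  refine le_trans (measure_mono fun m hm => ?_)
    (SMulInvariantMeasure.measure_preimage_smul A⁻¹ hmeas).le
  have hA' : c ≤ nearness z (moebius A.1 z₀) := by
    have h : ((m₀ : Ball n) : Cn n) = moebius A.1 z₀ := congrArg Subtype.val hAm.symm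
    rwa [h] at hA
  have hm' : c ≤ nearness z ((m : Ball n) : Cn n) := hm
  change c ^ 2 / 4 ≤ nearness (z₀ : Cn n) (moebius (A.1)⁻¹ ((m : Ball n) : Cn n))
  rw [← nearness_moebius A.1 z₀.2 (moebius_mem _ (m : Ball n).2)]
  have h1 := moebius_inv_moebius (A.1)⁻¹ (m : Ball n).2
  rw [inv_inv] at h1
  rw [h1]
  have h2 := nearness_mul_nearness_le (moebius_mem A.1 z₀.2) (m : Ball n).2 hz
  rw [nearness_comm _ z] at h2
  have h3 := mul_le_mul hA' hm' hc (hc.trans hA')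
  linarith

/-! ### Square integrability of restrictions -/

variable [Fact ((n : ℝ) < lam)]

theorem restrictFun_apply (f : Bergman n lam) (h : Htilde H) :
    restrictFun lam H z₀ f h = autj lam (h : Cover n) z₀ * hol f (h • z₀ : Ball n) := rfl

/-- The value Rf(h) is the value at z₀ of the translate of f by h. The local estimate at z₀, applied
to this translate, becomes after a change of variables an integral over the points near h·z₀, with
constants independent of h. -/
theorem exists_enorm_restrictFun_sq_le (H : ClosedSubgroup (SU n)) (z₀ : Ball n) :
    ∃ c : ℝ, 0 < c ∧ ∃ C : ℝ≥0∞, C ≠ ∞ ∧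
      ∀ (f : Bergman n lam) (h : Htilde H), ‖restrictFun lam H z₀ f h‖ₑ ^ 2 ≤
        C * ∫⁻ z, ‖(f : L2 n lam) z‖ₑ ^ 2 *
          (nearSet n c).indicator 1 (z, ((h • z₀ : Ball n) : Cn n)) ∂(bergmanMeasure n lam) := by
  obtain ⟨c, hc, C, hC, hF⟩ := exists_enorm_sq_le (lam := lam) z₀
  refine ⟨c, hc, C, hC, fun f h => ?_⟩
  have h1 := hF _ (differentiableOn_autjExt_mul (lam := lam) (h : Cover n)
    (hol_differentiableOn f))
  rw [autjExt_coe] at h1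
  refine h1.trans (le_of_eq ?_)
  congr 1
  have h2 : ∫⁻ z, ‖(f : L2 n lam) z‖ₑ ^ 2 *
      (nearSet n c).indicator 1 (z, ((h • z₀ : Ball n) : Cn n)) ∂(bergmanMeasure n lam) =
      ∫⁻ z, ‖hol f z‖ₑ ^ 2 *
      (nearSet n c).indicator 1 (z, ((h • z₀ : Ball n) : Cn n)) ∂(bergmanMeasure n lam) := by
    refine lintegral_congr_ae ?_
    filter_upwards [coe_ae_eq_hol f] with z hz
    rw [hz]
  rw [h2, ← lintegral_autjExt_mul (h : Cover n) (hol f) fun z =>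
    (nearSet n c).indicator 1 (z, ((h • z₀ : Ball n) : Cn n))]
  refine lintegral_congr_ae ?_
  filter_upwards [ae_mem_ball n lam] with z hz
  congr 1
  have h3 : ((h • z₀ : Ball n) : Cn n) = moebius (h : Cover n).base z₀ := rfl
  have h4 : (z, (z₀ : Cn n)) ∈ nearSet n c ↔
      (moebius (h : Cover n).base z, ((h • z₀ : Ball n) : Cn n)) ∈ nearSet n c := by
    rw [h3, nearSet, Set.mem_ofPred_eq, Set.mem_ofPred_eq, nearness_moebius _ hz z₀.2]
  by_cases h5 : (z, (z₀ : Cn n)) ∈ nearSet n c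
  · rw [Set.indicator_of_mem h5, Set.indicator_of_mem (h4.1 h5)]
    rfl
  · rw [Set.indicator_of_notMem h5, Set.indicator_of_notMem fun h => h5 (h4.2 h)]

/-- The restriction operator is bounded. -/
theorem exists_lintegral_restrictFun_le [SMulInvariantMeasure H.toSubgroup (Orb H z₀) μ]
    (hD : (fun h : Htilde H => autj lam (h : Cover n) z₀) ∈ sections lam μ) :
    ∃ C : ℝ≥0∞, C ≠ ∞ ∧ ∀ f : Bergman n lam,
      ∫⁻ m, ‖restrictFun lam H z₀ f (liftPt H z₀ m)‖ₑ ^ 2 ∂μ ≤ C * ENNReal.ofReal ‖f‖ ^ 2 := by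
  have hlam : 0 ≤ lam := (Nat.cast_nonneg n).trans (Fact.out (p := (n : ℝ) < lam)).le
  have := sigmaFinite_of_mem_sections hD hlam
  have hsf : SFinite (bergmanMeasure n lam) := by
    unfold bergmanMeasure ballVolume
    infer_instance
  obtain ⟨c, hc, C, hC, hR⟩ := exists_enorm_restrictFun_sq_le (lam := lam) H z₀
  set N : ℝ≥0∞ := μ {m | c ^ 2 / 4 ≤ nearness (z₀ : Cn n) ((m : Ball n) : Cn n)} with hN
  have hNt : N ≠ ∞ := (measure_nearness_ge_lt_top hD hlam (by positivity)).ne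
  refine ⟨C * N, ENNReal.mul_ne_top hC hNt, fun f => ?_⟩
  have hind : Measurable fun p : Orb H z₀ × Cn n =>
      (nearSet n c).indicator (1 : Cn n × Cn n → ℝ≥0∞) (p.2, ((p.1 : Ball n) : Cn n)) :=
    measurable_indicator_nearSet c measurable_snd (measurable_coe_orb.comp measurable_fst)
  have hf : AEMeasurable (fun z => ‖(f : L2 n lam) z‖ₑ ^ 2) (bergmanMeasure n lam) :=
    (Lp.aestronglyMeasurable (f : L2 n lam)).enorm.pow_const 2
  calc ∫⁻ m, ‖restrictFun lam H z₀ f (liftPt H z₀ m)‖ₑ ^ 2 ∂μ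
      ≤ ∫⁻ m, C * ∫⁻ z, ‖(f : L2 n lam) z‖ₑ ^ 2 *
          (nearSet n c).indicator 1 (z, ((m : Ball n) : Cn n)) ∂(bergmanMeasure n lam) ∂μ := by
        refine lintegral_mono fun m => ?_
        have h := hR f (liftPt H z₀ m)
        rwa [coe_liftPt_smul] at h
    _ = C * ∫⁻ m, ∫⁻ z, ‖(f : L2 n lam) z‖ₑ ^ 2 *
          (nearSet n c).indicator 1 (z, ((m : Ball n) : Cn n)) ∂(bergmanMeasure n lam) ∂μ :=
        lintegral_const_mul' _ _ hC
    -- Tonelli exchanges the integrals: the inner one becomes the measure of the orbit points near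
    -- z, which is at most `N` for every z in the ball.
    _ = C * ∫⁻ z, ∫⁻ m, ‖(f : L2 n lam) z‖ₑ ^ 2 *
          (nearSet n c).indicator 1 (z, ((m : Ball n) : Cn n)) ∂μ ∂(bergmanMeasure n lam) := by
        rw [lintegral_lintegral_swap]
        exact (hf.comp_quasiMeasurePreserving Measure.quasiMeasurePreserving_snd).mul
          hind.aemeasurable
    _ ≤ C * ∫⁻ z, ‖(f : L2 n lam) z‖ₑ ^ 2 * N ∂(bergmanMeasure n lam) := by
        refine mul_le_mul_right (lintegral_mono_ae ?_) _
        filter_upwards [ae_mem_ball n lam] with z hz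
        have hindz : Measurable fun m : Orb H z₀ =>
            (nearSet n c).indicator (1 : Cn n × Cn n → ℝ≥0∞) (z, ((m : Ball n) : Cn n)) :=
          measurable_indicator_nearSet c measurable_const measurable_coe_orb
        rw [lintegral_const_mul _ hindz]
        refine mul_le_mul_right ?_ _
        refine le_trans (le_of_eq ?_) (measure_nearness_ge_le hc.le hz)
        have hset := measurableSet_nearness_ge (H := H) (z₀ := z₀) c z
        rw [← lintegral_indicator_one hset]
        rfl
    _ = C * N * ENNReal.ofReal ‖f‖ ^ 2 := by
        rw [lintegral_mul_const'' _ hf, ← eLpNorm_two_sq, ← Lp.enorm_def, ← ofReal_norm]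
        rw [mul_comm _ N, ← mul_assoc]
        rfl

theorem measurable_restrictFun
    (hD : (fun h : Htilde H => autj lam (h : Cover n) z₀) ∈ sections lam μ) (f : Bergman n lam) :
    Measurable (restrictFun lam H z₀ f) := by
  refine hD.1.mul ?_
  have h : Continuous fun h : Htilde H => (h • z₀ : Ball n) :=
    (Cover.continuous_smul_left z₀).comp continuous_subtype_val
  exact ((hol_differentiableOn f).continuousOn.comp_continuous
    (continuous_subtype_val.comp h) fun h => (h • z₀ : Ball n).2).measurable

theorem covariant_restrictFun (f : Bergman n lam) :
    Covariant lam H z₀ (restrictFun lam H z₀ f) := by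
  intro h k hk
  have hk' : (k : Cover n) • z₀ = z₀ := hk
  rw [restrictFun_apply, restrictFun_apply, mul_smul, hk, chi, inv_inv, Subgroup.coe_mul, autj_mul,
    hk']
  ring

/-- By the bound, every element of the Bergman space lies in the domain of `R`; so domain membership
of T_φ R*f costs nothing. -/
theorem restrictFun_mem_sections [SMulInvariantMeasure H.toSubgroup (Orb H z₀) μ]
    (hD : (fun h : Htilde H => autj lam (h : Cover n) z₀) ∈ sections lam μ)
    (f : Bergman n lam) : restrictFun lam H z₀ f ∈ sections lam μ := by
  have hm := measurable_restrictFun hD f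
  have hc := covariant_restrictFun (H := H) (z₀ := z₀) f
  refine ⟨hm, hc, ?_, ?_⟩
  · refine AEStronglyMeasurable.congr (measurable_conj_mul hc hc hm hm).norm.aestronglyMeasurable ?_
    refine Filter.Eventually.of_forall fun m => ?_
    simp only [norm_mul, RCLike.norm_conj]
    rw [sq]
  · obtain ⟨C, hC, h⟩ := exists_lintegral_restrictFun_le hD
    refine lt_of_le_of_lt (le_of_eq ?_) ((h f).trans_lt
      (ENNReal.mul_lt_top hC.lt_top (by simp)))
    refine lintegral_congr fun m => ?_
    rw [← ofReal_norm, norm_pow, norm_norm, ENNReal.ofReal_pow (norm_nonneg _), ofReal_norm]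

theorem exists_norm_restrictOp_le [SMulInvariantMeasure H.toSubgroup (Orb H z₀) μ]
    (hD : (fun h : Htilde H => autj lam (h : Cover n) z₀) ∈ sections lam μ) :
    ∃ C : ℝ, ∀ f : (restrictOp lam μ).domain, ‖restrictOp lam μ f‖ ≤ C * ‖f‖ := by
  obtain ⟨C, hC, h⟩ := exists_lintegral_restrictFun_le hD
  refine ⟨Real.sqrt C.toReal, fun f => ?_⟩
  have hsq : ‖restrictOp lam μ f‖ ^ 2 =
      ∫ m, ‖restrictFun lam H z₀ f.1 (liftPt H z₀ m)‖ ^ 2 ∂μ := by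
    have h1 : (inner ℂ (restrictOp lam μ f) (restrictOp lam μ f) : ℂ) =
        ∫ m, conj (restrictFun lam H z₀ f.1 (liftPt H z₀ m)) *
          restrictFun lam H z₀ f.1 (liftPt H z₀ m) ∂μ := rfl
    rw [inner_self_eq_norm_sq_to_K] at h1
    have h2 : (∫ m, conj (restrictFun lam H z₀ f.1 (liftPt H z₀ m)) *
          restrictFun lam H z₀ f.1 (liftPt H z₀ m) ∂μ) =
        ((∫ m, ‖restrictFun lam H z₀ f.1 (liftPt H z₀ m)‖ ^ 2 ∂μ : ℝ) : ℂ) := by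
      rw [← integral_complex_ofReal]
      simp [Complex.conj_mul']
    rw [h2] at h1
    refine Complex.ofReal_injective ?_
    rw [Complex.ofReal_pow]
    exact h1
  have hle : ‖restrictOp lam μ f‖ ^ 2 ≤ C.toReal * ‖f‖ ^ 2 := by
    rw [hsq, integral_eq_lintegral_of_nonneg_ae
      (Filter.Eventually.of_forall fun m => by positivity)
      (restrictFun_mem_sections hD f.1).2.2.aestronglyMeasurable]
    have h3 := ENNReal.toReal_mono (ENNReal.mul_ne_top hC (by simp)) (h f.1)
    rw [ENNReal.toReal_mul, ENNReal.toReal_pow, ENNReal.toReal_ofReal (norm_nonneg _)] at h3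
    refine le_trans (le_of_eq ?_) h3
    congr 1
    refine lintegral_congr fun m => ?_
    rw [ENNReal.ofReal_pow (norm_nonneg _), ofReal_norm]
  refine abs_le_of_sq_le_sq' ?_ (by positivity) |>.2
  rwa [mul_pow, Real.sq_sqrt ENNReal.toReal_nonneg]

end Restriction

/-! ### Convolution by the kernel of a Toeplitz operator -/

section Convolution

variable {n : ℕ} {lam : ℝ}

theorem bergman_inner_conj_symm (a b : Bergman n lam) : conj (inner ℂ b a) = inner ℂ a b :=
  inner_conj_symm (𝕜 := ℂ) (a : L2 n lam) (b : L2 n lam)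

variable [Fact ((n : ℝ) < lam)]

/-- Riesz representation of the functional `f ↦ ⟨K_w, φ f⟩` on the Bergman space. -/
theorem exists_inner_eq_inner_smul (φ : Lp ℂ ∞ (bergmanMeasure n lam)) (a : Bergman n lam) :
    ∃ u : Bergman n lam, ∀ f : Bergman n lam,
      inner ℂ u f = inner ℂ (a : L2 n lam) (φ • (f : L2 n lam) : L2 n lam) := by
  let L : Bergman n lam →ₗ[ℂ] ℂ :=
    { toFun := fun f => inner ℂ (a : L2 n lam) (φ • (f : L2 n lam) : L2 n lam)
      map_add' := fun f g => by rw [Submodule.coe_add, Lp.add_smul, inner_add_right]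
      map_smul' := fun c f => by
        rw [Submodule.coe_smul, ← Lp.smul_comm, inner_smul_right]
        rfl }
  let ℓ : Bergman n lam →L[ℂ] ℂ := L.mkContinuous (‖(a : L2 n lam)‖ * ‖φ‖) fun f => by
    refine (norm_inner_le_norm (𝕜 := ℂ) (a : L2 n lam) (φ • (f : L2 n lam) : L2 n lam)).trans ?_
    rw [mul_assoc]
    exact mul_le_mul_of_nonneg_left (Lp.norm_smul_le φ (f : L2 n lam)) (norm_nonneg _)
  exact ⟨(InnerProductSpace.toDual ℂ (Bergman n lam)).symm ℓ, fun f => by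
    rw [InnerProductSpace.toDual_symm_apply]; rfl⟩

/-- The projection drops out because the kernel element already lies in the Bergman space. -/
theorem hol_toeplitz (φ : Lp ℂ ∞ (bergmanMeasure n lam)) (f : Bergman n lam) (w : Ball n) :
    hol (toeplitz φ f) w =
      inner ℂ (kernelAt n lam w : L2 n lam) (φ • (f : L2 n lam) : L2 n lam) := by
  rw [← inner_kernelAt, toeplitz]
  exact (Bergman n lam).inner_orthogonalProjectionOnto_eq_of_mem_left _ _

variable {H : ClosedSubgroup (SU n)} {z₀ : Ball n}

/-- Moving both kernel elements by k turns the points k⁻¹h·z₀ and z₀ into h·z₀ and k·z₀. The cocycle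
identity merges j(k, k⁻¹h·z₀) and j(k⁻¹h, z₀) into j(h, z₀). Invariance of φ is used for the single
element k only, so the exceptional null set may depend on it. -/
theorem nu_inv_mul {φ : Lp ℂ ∞ (bergmanMeasure n lam)}
    (hφ : ∀ A ∈ H, ∀ᵐ z ∂(bergmanMeasure n lam), φ (moebius A z) = φ z) (k h : Htilde H) :
    nu lam H z₀ φ (k⁻¹ * h) = autj lam (h : Cover n) z₀ * conj (autj lam (k : Cover n) z₀) *
      inner ℂ (kernelAt n lam (h • z₀) : L2 n lam)
        (φ • (kernelAt n lam (k • z₀) : L2 n lam) : L2 n lam) := by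
  have h1 := inner_kernelAt_smul (lam := lam) (k : Cover n) (hφ _ k.2) ((k⁻¹ * h) • z₀) z₀
  have h2 : (k : Cover n) • ((k⁻¹ * h) • z₀ : Ball n) = h • z₀ := by
    change k • (k⁻¹ * h) • z₀ = h • z₀
    rw [smul_smul, mul_inv_cancel_left]
  have h3 : autj lam (h : Cover n) z₀ =
      autj lam (k : Cover n) ((k⁻¹ * h) • z₀) * autj lam ((k⁻¹ * h : Htilde H) : Cover n) z₀ := by
    have h4 := autj_mul (lam := lam) (k : Cover n) ((k⁻¹ * h : Htilde H) : Cover n) z₀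
    rw [← Subgroup.coe_mul, mul_inv_cancel_left] at h4
    exact h4
  rw [h2] at h1
  rw [nu, h1, h3]
  have h5 : ((k : Cover n) • z₀ : Ball n) = k • z₀ := rfl
  rw [h5]
  ring

/-- The integrand of the convolution is, up to a factor independent of k, the integrand of the inner
product of Ru and f. Descent to the orbit, integrability and the value of the convolution all follow
from this. -/
theorem mul_nu_eq {φ : Lp ℂ ∞ (bergmanMeasure n lam)}
    (hφ : ∀ A ∈ H, ∀ᵐ z ∂(bergmanMeasure n lam), φ (moebius A z) = φ z) {h : Htilde H}
    {u : Bergman n lam} (hu : ∀ f : Bergman n lam, inner ℂ u f =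
      inner ℂ (kernelAt n lam (h • z₀) : L2 n lam) (φ • (f : L2 n lam) : L2 n lam))
    (f : Htilde H → ℂ) (k : Htilde H) :
    f k * nu lam H z₀ φ (k⁻¹ * h) =
      autj lam (h : Cover n) z₀ * (conj (restrictFun lam H z₀ u k) * f k) := by
  rw [nu_inv_mul hφ, ← hu, restrictFun_apply, ← inner_kernelAt, map_mul, bergman_inner_conj_symm]
  ring

end Convolution

end

end BallToeplitz

/-! ### The main theorem -/

theorem mainTheorem1 (n : ℕ) (hn : 1 ≤ n) (lam : ℝ) [hlam : Fact ((n : ℝ) < lam)]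
    (H : ClosedSubgroup (SU n)) (z₀ : Ball n)
    (μ : Measure (Orb H z₀)) [IsFiniteMeasureOnCompacts μ]
    [SMulInvariantMeasure H.toSubgroup (Orb H z₀) μ] (hμ : μ ≠ 0)
    (hinj : RestrictionInjective H z₀)
    (hD : (fun h : Htilde H => autj lam (h : Cover n) z₀) ∈ sections lam μ)
    (φ : Lp ℂ ∞ (bergmanMeasure n lam))
    (hφ : ∀ A ∈ H, ∀ᵐ z ∂(bergmanMeasure n lam), φ (moebius A z) = φ z) :
    (∀ h : Htilde H, nu lam H z₀ φ h = autj lam (h : Cover n) z₀ *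
      ∫ z, φ z * hol (kernelAt n lam z₀) z * conj (hol (kernelAt n lam (h • z₀)) z)
        ∂(bergmanMeasure n lam)) ∧
    Dense ((restrictOp lam μ).domain : Set (Bergman n lam)) ∧
    ∀ (f : Htilde H → ℂ) (hf : f ∈ sections lam μ),
      (∀ h : Htilde H,
        RightInvariant H z₀ (fun k => f k * nu lam H z₀ φ (k⁻¹ * h)) ∧
        Integrable (fun m => f (liftPt H z₀ m) * nu lam H z₀ φ ((liftPt H z₀ m)⁻¹ * h)) μ) ∧
      ∃ (hdom : L2chi.mk f hf ∈ (restrictOp lam μ).adjoint.domain)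
        (hT : toeplitz φ ((restrictOp lam μ).adjoint ⟨L2chi.mk f hf, hdom⟩) ∈
          (restrictOp lam μ).domain)
        (hconv : convol μ f (nu lam H z₀ φ) ∈ sections lam μ),
        restrictOp lam μ ⟨toeplitz φ ((restrictOp lam μ).adjoint ⟨L2chi.mk f hf, hdom⟩), hT⟩ =
          L2chi.mk (convol μ f (nu lam H z₀ φ)) hconv ∧
        L2chi.mk (convol μ f (nu lam H z₀ φ)) hconv ∈ rangeClosure lam μ ∧
        ∀ h : Htilde H,
          restrictFun lam H z₀
            (toeplitz φ ((restrictOp lam μ).adjoint ⟨L2chi.mk f hf, hdom⟩)) h =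
            convol μ f (nu lam H z₀ φ) h := by
  have hRmem : ∀ f : Bergman n lam, f ∈ (restrictOp lam μ).domain := fun f =>
    restrictFun_mem_sections hD f
  have hdense : Dense ((restrictOp lam μ).domain : Set (Bergman n lam)) := by
    have : ((restrictOp lam μ).domain : Set (Bergman n lam)) = Set.univ :=
      Set.eq_univ_of_forall hRmem
    rw [this]
    exact dense_univ
  refine ⟨fun h => by rw [nu, inner_coe_smul_eq_integral], hdense, fun f hf => ?_⟩
  have hdom : L2chi.mk f hf ∈ (restrictOp lam μ).adjoint.domain := by
    obtain ⟨C, hC⟩ := exists_norm_restrictOp_le hD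
    rw [LinearPMap.mem_adjoint_domain_iff]
    -- Membership in the adjoint domain is continuity of x ↦ ⟨f, Rx⟩, which follows from
    -- Cauchy–Schwarz and the bound for `R`.
    refine AddMonoidHomClass.continuous_of_bound _ (‖L2chi.mk f hf‖ * C) fun x => ?_
    refine (norm_inner_le_norm (𝕜 := ℂ) (L2chi.mk f hf) (restrictOp lam μ x)).trans ?_
    rw [mul_assoc]
    exact mul_le_mul_of_nonneg_left (hC x) (norm_nonneg _)
  set w : Bergman n lam := (restrictOp lam μ).adjoint ⟨L2chi.mk f hf, hdom⟩ with hw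
  -- The adjoint relation with its sides conjugated, so that Ru stands in the conjugate linear
  -- variable as in `mul_nu_eq`.
  have hadj : ∀ u : Bergman n lam, inner ℂ u w =
      ∫ m, conj (restrictFun lam H z₀ u (liftPt H z₀ m)) * f (liftPt H z₀ m) ∂μ := by
    intro u
    have h1 := LinearPMap.adjoint_isFormalAdjoint hdense ⟨L2chi.mk f hf, hdom⟩ ⟨u, hRmem u⟩
    have h2 : inner ℂ u w = inner ℂ (restrictOp lam μ ⟨u, hRmem u⟩) (L2chi.mk f hf) := by
      rw [← bergman_inner_conj_symm, ← inner_conj_symm (restrictOp lam μ ⟨u, hRmem u⟩)]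
      exact congrArg conj h1
    exact h2
  have hpoint : ∀ h : Htilde H, restrictFun lam H z₀ (toeplitz φ w) h =
      convol μ f (nu lam H z₀ φ) h := by
    intro h
    -- The vector u moves φ and K_{h·z₀} to the left of the pairing with R*f, where the adjoint
    -- relation applies.
    obtain ⟨u, hu⟩ := exists_inner_eq_inner_smul φ (kernelAt n lam (h • z₀))
    rw [restrictFun_apply, hol_toeplitz, ← hu, hadj, convol, ← integral_const_mul]
    exact integral_congr_ae (Filter.Eventually.of_forall fun m => (mul_nu_eq hφ hu f _).symm)
  have hfun : restrictFun lam H z₀ (toeplitz φ w) = convol μ f (nu lam H z₀ φ) := funext hpoint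
  have hconv : convol μ f (nu lam H z₀ φ) ∈ sections lam μ :=
    hfun ▸ restrictFun_mem_sections hD (toeplitz φ w)
  have heq : restrictOp lam μ ⟨toeplitz φ w, hRmem _⟩ =
      L2chi.mk (convol μ f (nu lam H z₀ φ)) hconv := by
    -- `L2chi.mk` carries a membership proof that depends on the function; with a variable in place
    -- of the convolution, the equality of functions can be substituted.
    have h : ∀ (g : Htilde H → ℂ) (hg : g ∈ sections lam μ),
        restrictFun lam H z₀ (toeplitz φ w) = g →
          restrictOp lam μ ⟨toeplitz φ w, hRmem _⟩ = L2chi.mk g hg := by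
      rintro g hg rfl
      rfl
    exact h _ hconv hfun
  refine ⟨fun h => ?_, hdom, hRmem _, hconv, heq, ?_, hpoint⟩
  · obtain ⟨u, hu⟩ := exists_inner_eq_inner_smul φ (kernelAt n lam (h • z₀))
    have hc := covariant_restrictFun (H := H) (z₀ := z₀) u
    refine ⟨fun k s hs => ?_, ?_⟩
    · simp only [mul_nu_eq hφ hu]
      -- Ru and f have the same unitary covariance, so the characters cancel in the product of
      -- conj(Ru) and f.
      exact congrArg _ (hc.conj_mul hf.2.1 k s hs)
    · simp only [mul_nu_eq hφ hu]
      exact (SectionSpace.integrable_conj_mul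
        (SectionSpace.of _ (restrictFun_mem_sections hD u)) (SectionSpace.of f hf)).const_mul _
  · rw [← heq]
    exact Submodule.le_topologicalClosure _ ⟨⟨toeplitz φ w, hRmem _⟩, rfl⟩
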